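/- By a half-line we mean a closed half-line, with its end point. A *long-legged* $\mathsf{Z}$ is a subset of the plane $\mathbb{R}^2$ consisting of two parallel half-lines pointing in opposite directions, together with a segment joining their end points that is not parallel to them; that is, a set consisting of the half-line from $p$ in direction $-a$, the segment from $p$ to $p+b$, and the half-line from $p+b$ in direction $a$, where $p,a,b\in\mathbb{R}^2$ and $a,b$ are linearly independent. A *long-legged* $\mathsf{W}$ is obtained from a long-legged $\mathsf{Z}$ by truncating the third arm to a segment and adding at its end a fourth arm, a half-line with the direction of the second arm; that is, it consists of the half-line from $p$ in direction $-a$, the segments from $p$ to $p+b$ and from $p+b$ to $p+b+a$, and the half-line from $p+b+a$ in direction $b$, where $a,b$ are linearly independent. A *long-legged* $\mathsf{M}$ is the mirror image of a long-legged $\mathsf{W}$ in the horizontal axis. The regions formed by a finite collection of such shapes are the connected components of the complement of their union in $\mathbb{R}^2$. Then for every integer $n\ge 0$: 1. the maximum number of regions formed by $n$ long-legged $\mathsf{W}$'s is $8n^2-7n+1$; 2. the maximum number of regions formed by $n$ long-legged $\mathsf{M}$'s is also $8n^2-7n+1$; 3. the maximum number of regions formed by $n$ long-legged $\mathsf{Z}$'s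 is $(9n^2-7n+2)/2$. In each case the $n$ shapes range over all possible choices, and the maximum is attained. -/

import Mathlib

/-- The closed half-line with end point `p` and direction `d`. -/
def halfLine (p d : ℝ × ℝ) : Set (ℝ × ℝ) :=
  {x | ∃ t : ℝ, 0 ≤ t ∧ x = p + t • d}

/-- A long-legged Z (zig-zag) in the plane: two parallel half-lines pointing in opposite
directions, whose end points `p` and `p + b` are joined by a segment not parallel to them. -/
def IsLongLeggedZ (S : Set (ℝ × ℝ)) : Prop :=
  ∃ p a b : ℝ × ℝ, LinearIndependent ℝ ![a, b] ∧
    S = halfLine p (-a) ∪ segment ℝ p (p + b) ∪ halfLine (p + b) a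

/-- A long-legged W in the plane: the third arm of a long-legged Z is truncated to a segment, and
a fourth arm is added at its end, a half-line parallel to (and in the direction of) the second arm.
Traversed from end to end, the four arms have directions `a`, `b`, `a`, `b`.
Rescaling `a` does not change the first arm, so the lengths of the two finite arms are arbitrary.
This family is exactly the orbit of one such shape under the affine group of the plane. -/
def IsLongLeggedW (S : Set (ℝ × ℝ)) : Prop :=
  ∃ p a b : ℝ × ℝ, LinearIndependent ℝ ![a, b] ∧
    S = halfLine p (-a) ∪ segment ℝ p (p + b) ∪ segment ℝ (p + b) (p + b + a) ∪
      halfLine (p + b + a) b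

/-- A long-legged M is a long-legged W turned upside down (reflected in the horizontal axis). -/
def IsLongLeggedM (S : Set (ℝ × ℝ)) : Prop :=
  ∃ W : Set (ℝ × ℝ), IsLongLeggedW W ∧ S = (fun x : ℝ × ℝ => (x.1, -x.2)) '' W

/-- The regions into which a subset `F` of the plane divides the plane: the connected components
of the complement of `F`. -/
def regions (F : Set (ℝ × ℝ)) : Set (Set (ℝ × ℝ)) :=
  {C | ∃ x ∈ Fᶜ, C = connectedComponentIn Fᶜ x}

/-- `m` is the maximum number of regions formed in the plane by drawing `n` copies of a shape,
the copies being the sets that satisfy `shape`. Numbers of regions are counted in `ℕ∞`, so that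
the maximality also says that no drawing has infinitely many regions. -/
def IsMaxRegions (shape : Set (ℝ × ℝ) → Prop) (n m : ℕ) : Prop :=
  IsGreatest {r : ℕ∞ | ∃ S : Fin n → Set (ℝ × ℝ),
    (∀ i, shape (S i)) ∧ r = (regions (⋃ i, S i)).encard} (m : ℕ∞)

open Filter Topology Set

/-! With d arms per curve (d = 3 for Z, d = 4 for W) the maximum is 1 + n + d² C(n, 2). The M's need
no separate count, since reflection carries the family of W's to itself. Regions are counted by
linear algebra over `ZMod 2`, through the functions that are locally constant off the union F of the
curves.

Upper bound (`rank_locConst_iUnion_le`). Every arm, suitably traversed, has direction a or b. So the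
curve is a graph over the sum of the coordinates in the basis a, b, and a homeomorphism of the plane
straightens it to the axis (`isStaircase_of_curve`). When the axis is added to a closed set F, the
jump of a function across the axis is constant on each gap of F there, and a function without jumps
extends across. So the dimension grows by at most the number of gaps
(`rank_locConst_union_axis_le`). Two arms meet in a convex set, whence n earlier curves cut the new
one in at most d² n intervals and leave at most d² n + 1 gaps. Intervals are counted, not points, so
overlapping arms need no general position argument.

Lower bound (`Profile.le_encard_regions`). If all arms span the strip |x| < 1 and cross simply
there, independent functions are the constant 1, the side function of each curve, and one function
per crossing v: the parity of the number of times an upward vertical ray meets the two half-curves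
that start at v. Summing values in the four sectors at v isolates the function of v. Thin curves
close to tangents of the parabola y = x² supply d² such crossings for each pair of curves
(`Profile.exists_drawing`). -/

/-! ### Regions and locally constant functions. -/

/-- The `ZMod 2`-valued functions on the plane that are locally constant off `F` and vanish
on `F`. -/
def locConst (F : Set (ℝ × ℝ)) : Submodule (ZMod 2) (ℝ × ℝ → ZMod 2) where
  carrier := {f | (∀ z ∉ F, ∀ᶠ w in 𝓝 z, f w = f z) ∧ ∀ z ∈ F, f z = 0}
  add_mem' := by
    rintro f g ⟨hf, hf'⟩ ⟨hg, hg'⟩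
    refine ⟨fun z hz => ?_, fun z hz => by simp [hf' z hz, hg' z hz]⟩
    filter_upwards [hf z hz, hg z hz] with w h1 h2
    simp [h1, h2]
  zero_mem' := ⟨fun z _ => by simp, fun z _ => rfl⟩
  smul_mem' := by
    rintro c f ⟨hf, hf'⟩
    refine ⟨fun z hz => ?_, fun z hz => by simp [hf' z hz]⟩
    filter_upwards [hf z hz] with w h1
    simp [h1]

theorem eq_of_isPreconnected_of_eventually {X : Type*} [TopologicalSpace X] {Y : Type*}
    {f : X → Y} {s : Set X} (hs : IsPreconnected s)
    (hf : ∀ z ∈ s, ∀ᶠ w in 𝓝 z, f w = f z) {x y : X} (hx : x ∈ s) (hy : y ∈ s) : f x = f y := by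
  let _ : TopologicalSpace Y := ⊥
  have _ : DiscreteTopology Y := ⟨rfl⟩
  refine hs.constant (f := f) (fun z hz => ?_) hx hy
  refine ContinuousAt.continuousWithinAt ?_
  have : (fun _ => f z) =ᶠ[𝓝 z] f := by
    filter_upwards [hf z hz] with w hw using hw.symm
  exact (continuousAt_const (y := f z)).congr this

/-- The indicators of the regions lie in `locConst F`, because the components of an open subset of
the plane are open. Evaluation at one point of each region shows that they are independent. -/
theorem encard_regions_le {F : Set (ℝ × ℝ)} (hF : IsClosed F) {m : ℕ}
    (h : Module.rank (ZMod 2) (locConst F) ≤ m) : (regions F).encard ≤ m := by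
  classical
  have hop : ∀ C ∈ regions F, IsOpen C := by
    rintro C ⟨x, hx, rfl⟩
    exact hF.isOpen_compl.connectedComponentIn
  have hsub : ∀ C ∈ regions F, C ⊆ Fᶜ := by
    rintro C ⟨x, hx, rfl⟩
    exact connectedComponentIn_subset _ _
  have hself : ∀ C ∈ regions F, ∀ z ∈ C, C = connectedComponentIn Fᶜ z := by
    rintro C ⟨x, hx, rfl⟩ z hz
    exact connectedComponentIn_eq hz
  have hmem : ∀ C : regions F, (C : Set (ℝ × ℝ)).indicator (fun _ => (1 : ZMod 2)) ∈ locConst F := by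
    rintro ⟨C, hC⟩
    refine ⟨fun z hz => ?_, fun z hz => indicator_of_notMem (fun h => hsub C hC h hz) _⟩
    have hz' : z ∈ connectedComponentIn Fᶜ z := mem_connectedComponentIn hz
    have ho : IsOpen (connectedComponentIn Fᶜ z) := hF.isOpen_compl.connectedComponentIn
    filter_upwards [ho.mem_nhds hz'] with w hw
    have hw' := connectedComponentIn_eq hw
    have : w ∈ C ↔ z ∈ C := by
      constructor
      · intro h
        rw [hself C hC w h, ← hw']; exact hz'
      · intro h
        rw [hself C hC z h]; exact hw
    simp [indicator_apply, this]
  have hpt : ∀ C : regions F, ∃ z, z ∈ (C : Set (ℝ × ℝ)) := by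
    rintro ⟨C, x, hx, rfl⟩
    exact ⟨x, mem_connectedComponentIn hx⟩
  choose q hq using hpt
  have hli : LinearIndependent (ZMod 2) (fun C : regions F => (⟨_, hmem C⟩ : locConst F)) := by
    rw [linearIndependent_iff']
    intro s g hg C hC
    have := congrArg (fun f : locConst F => (f : ℝ × ℝ → ZMod 2) (q C)) hg
    simp only [Submodule.coe_sum, Submodule.coe_smul, Finset.sum_apply, Pi.smul_apply,
      ZeroMemClass.coe_zero, Pi.zero_apply] at this
    rw [Finset.sum_eq_single C] at this
    · simpa [indicator_of_mem (hq C)] using this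
    · intro D _ hD
      have : q C ∉ (D : Set (ℝ × ℝ)) := fun h => hD (Subtype.ext (by
        rw [hself D D.2 _ h, ← hself C C.2 _ (hq C)]))
      simp [indicator_of_notMem this]
    · exact fun h => (h hC).elim
  have hc := hli.cardinal_le_rank.trans h
  rw [← Set.toENat_cardinalMk]
  simpa using Cardinal.toENat.monotone' hc

/-- Off F such functions are determined by their values at one point of each region, so independent
ones embed in `regions F → ZMod 2`. Their values on F are irrelevant. -/
theorem card_le_encard_regions {F : Set (ℝ × ℝ)} {ι : Type*} [Fintype ι]
    (g : ι → ℝ × ℝ → ZMod 2) (hg : ∀ i, ∀ z ∉ F, ∀ᶠ w in 𝓝 z, g i w = g i z)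
    (hli : ∀ c : ι → ZMod 2, (∀ z ∉ F, ∑ i, c i * g i z = 0) → ∀ i, c i = 0) :
    (Fintype.card ι : ℕ∞) ≤ (regions F).encard := by
  classical
  by_cases hfin : (regions F).Finite
  swap
  · rw [Set.Infinite.encard_eq hfin]; exact le_top
  have _ : Fintype (regions F) := hfin.fintype
  have hpt : ∀ C : regions F, ∃ z, z ∉ F ∧ (C : Set (ℝ × ℝ)) = connectedComponentIn Fᶜ z := by
    rintro ⟨C, x, hx, rfl⟩
    exact ⟨x, hx, rfl⟩
  choose q hq hq' using hpt
  have hl : LinearIndependent (ZMod 2) (fun i => (fun C => g i (q C) : regions F → ZMod 2)) := by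
    rw [Fintype.linearIndependent_iff]
    intro c hc
    refine hli c fun z hz => ?_
    have := congrFun hc ⟨connectedComponentIn Fᶜ z, z, hz, rfl⟩
    simp only [Finset.sum_apply, Pi.smul_apply, smul_eq_mul, Pi.zero_apply] at this
    rw [← this]
    refine Finset.sum_congr rfl fun i _ => ?_
    congr 1
    refine eq_of_isPreconnected_of_eventually (isPreconnected_connectedComponentIn (x := z))
      (fun w hw => hg i w (connectedComponentIn_subset _ _ hw)) (mem_connectedComponentIn hz) ?_
    have h1 : connectedComponentIn Fᶜ z = _ := hq' ⟨connectedComponentIn Fᶜ z, z, hz, rfl⟩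
    have h2 := mem_connectedComponentIn (F := Fᶜ) (hq ⟨connectedComponentIn Fᶜ z, z, hz, rfl⟩)
    rw [← h1] at h2
    exact h2
  have := hl.fintype_card_le_finrank
  rw [Module.finrank_fintype_fun_eq_card] at this
  rw [Set.encard_eq_coe_toFinset_card, Set.toFinset_card]
  exact_mod_cast this

theorem rank_locConst_preimage (Ψ : ℝ × ℝ ≃ₜ ℝ × ℝ) (F : Set (ℝ × ℝ)) :
    Module.rank (ZMod 2) (locConst (Ψ ⁻¹' F)) = Module.rank (ZMod 2) (locConst F) := by
  have hle : ∀ (Φ : ℝ × ℝ ≃ₜ ℝ × ℝ) (F : Set (ℝ × ℝ)),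
      Module.rank (ZMod 2) (locConst F) ≤ Module.rank (ZMod 2) (locConst (Φ ⁻¹' F)) := by
    intro Φ F
    have hm : ∀ f ∈ locConst F, LinearMap.funLeft (ZMod 2) (ZMod 2) Φ f ∈ locConst (Φ ⁻¹' F) := by
      rintro f ⟨hf, hf'⟩
      exact ⟨fun z hz => Φ.continuous.continuousAt.eventually (hf (Φ z) hz),
        fun z hz => hf' (Φ z) hz⟩
    refine LinearMap.rank_le_of_injective ((LinearMap.funLeft (ZMod 2) (ZMod 2) Φ).restrict hm) ?_
    intro f g hfg
    have := congrArg Subtype.val hfg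
    exact Subtype.ext (LinearMap.funLeft_injective_of_surjective (ZMod 2) (ZMod 2) Φ Φ.surjective this)
  refine le_antisymm ?_ (hle Ψ F)
  refine (hle Ψ.symm (Ψ ⁻¹' F)).trans_eq ?_
  rw [show Ψ.symm ⁻¹' (Ψ ⁻¹' F) = F by ext; simp]

/-! ### Adding the axis to a closed set. -/

/-- The horizontal axis. -/
def axis : Set (ℝ × ℝ) := {z | z.2 = 0}

theorem isClosed_axis : IsClosed axis := isClosed_eq continuous_snd continuous_const

theorem exists_box {F : Set (ℝ × ℝ)} (hF : IsClosed F) {t : ℝ} (ht : (t, 0) ∉ F) :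
    ∃ δ > 0, ∀ z : ℝ × ℝ, |z.1 - t| < δ → |z.2| < δ → z ∉ F := by
  obtain ⟨δ, hδ, h⟩ := Metric.mem_nhds_iff.1 (hF.isOpen_compl.mem_nhds ht)
  refine ⟨δ, hδ, fun z h1 h2 => h ?_⟩
  rw [Metric.mem_ball, Prod.dist_eq, Real.dist_eq, Real.dist_eq]
  simpa using ⟨h1, h2⟩

theorem eq_on_upper_box {F : Set (ℝ × ℝ)} {t δ : ℝ}
    (h : ∀ z : ℝ × ℝ, |z.1 - t| < δ → |z.2| < δ → z ∉ F) {f : ℝ × ℝ → ZMod 2}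
    (hf : f ∈ locConst (F ∪ axis)) {z w : ℝ × ℝ} (hz : |z.1 - t| < δ) (hz0 : 0 < z.2)
    (hz2 : z.2 < δ) (hw : |w.1 - t| < δ) (hw0 : 0 < w.2) (hw2 : w.2 < δ) : f z = f w := by
  have hc : Convex ℝ (Ioo (t - δ) (t + δ) ×ˢ Ioo 0 δ) := (convex_Ioo _ _).prod (convex_Ioo _ _)
  refine eq_of_isPreconnected_of_eventually hc.isPreconnected (fun x hx => hf.1 x ?_) ?_ ?_
  · rintro (hxF | hxF)
    · refine h x ?_ ?_ hxF
      · rw [abs_lt]; constructor <;> linarith [hx.1.1, hx.1.2]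
      · rw [abs_lt]; constructor <;> linarith [hx.2.1, hx.2.2]
    · exact hx.2.1.ne' hxF
  · rw [abs_lt] at hz
    exact ⟨⟨by linarith, by linarith⟩, hz0, hz2⟩
  · rw [abs_lt] at hw
    exact ⟨⟨by linarith, by linarith⟩, hw0, hw2⟩

theorem eq_on_lower_box {F : Set (ℝ × ℝ)} {t δ : ℝ}
    (h : ∀ z : ℝ × ℝ, |z.1 - t| < δ → |z.2| < δ → z ∉ F) {f : ℝ × ℝ → ZMod 2}
    (hf : f ∈ locConst (F ∪ axis)) {z w : ℝ × ℝ} (hz : |z.1 - t| < δ) (hz0 : z.2 < 0)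
    (hz2 : -δ < z.2) (hw : |w.1 - t| < δ) (hw0 : w.2 < 0) (hw2 : -δ < w.2) : f z = f w := by
  have hc : Convex ℝ (Ioo (t - δ) (t + δ) ×ˢ Ioo (-δ) 0) := (convex_Ioo _ _).prod (convex_Ioo _ _)
  refine eq_of_isPreconnected_of_eventually hc.isPreconnected (fun x hx => hf.1 x ?_) ?_ ?_
  · rintro (hxF | hxF)
    · refine h x ?_ ?_ hxF
      · rw [abs_lt]; constructor <;> linarith [hx.1.1, hx.1.2]
      · rw [abs_lt]; constructor <;> linarith [hx.2.1, hx.2.2]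
    · exact hx.2.2.ne hxF
  · rw [abs_lt] at hz
    exact ⟨⟨by linarith, by linarith⟩, hz2, hz0⟩
  · rw [abs_lt] at hw
    exact ⟨⟨by linarith, by linarith⟩, hw2, hw0⟩

/-- Adding the axis to a closed set `F` adds at most as many regions as there are gaps of `F`
on the axis. -/
theorem rank_locConst_union_axis_le {F : Set (ℝ × ℝ)} (hF : IsClosed F) {M : ℕ} (N : ℝ → Fin M)
    (hN : ∀ t t', (t, 0) ∉ F → (t', 0) ∉ F → N t = N t' → ∀ s ∈ uIcc t t', (s, (0 : ℝ)) ∉ F) :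
    Module.rank (ZMod 2) (locConst (F ∪ axis)) ≤ Module.rank (ZMod 2) (locConst F) + M := by
  classical
  have hex : ∀ t : ℝ, ∃ δ > 0, (t, (0 : ℝ)) ∉ F →
      ∀ z : ℝ × ℝ, |z.1 - t| < δ → |z.2| < δ → z ∉ F := by
    intro t
    by_cases ht : (t, (0 : ℝ)) ∈ F
    · exact ⟨1, one_pos, fun h => (h ht).elim⟩
    · obtain ⟨δ, h1, h2⟩ := exists_box hF ht
      exact ⟨δ, h1, fun _ => h2⟩
  choose δ hδ hbox using hex
  -- The jump of f across the axis at abscissa t, sampled inside a box that avoids F.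
  let J : ℝ → (ℝ × ℝ → ZMod 2) → ZMod 2 := fun t f => f (t, δ t / 2) - f (t, -(δ t / 2))
  -- values near the axis
  have up : ∀ f ∈ locConst (F ∪ axis), ∀ t, (t, (0 : ℝ)) ∉ F → ∀ t', (t', (0 : ℝ)) ∉ F →
      |t' - t| < δ t → f (t', δ t' / 2) = f (t, δ t / 2) := by
    intro f hf t ht t' ht' htt
    have h1 : 0 < min (δ t) (δ t') := lt_min (hδ t) (hδ t')
    have a1 := min_le_left (δ t) (δ t')
    have a2 := min_le_right (δ t) (δ t')
    have e1 : f (t', δ t' / 2) = f (t', min (δ t) (δ t') / 2) :=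
      eq_on_upper_box (hbox t' ht') hf (by simpa using hδ t') (by linarith [hδ t'])
        (by linarith [hδ t']) (by simpa using hδ t') (by simpa using h1) (by dsimp; linarith)
    rw [e1]
    exact eq_on_upper_box (hbox t ht) hf htt (by simpa using h1) (by dsimp; linarith)
      (by simpa using hδ t) (by linarith [hδ t]) (by linarith [hδ t])
  have down : ∀ f ∈ locConst (F ∪ axis), ∀ t, (t, (0 : ℝ)) ∉ F → ∀ t', (t', (0 : ℝ)) ∉ F →
      |t' - t| < δ t → f (t', -(δ t' / 2)) = f (t, -(δ t / 2)) := by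
    intro f hf t ht t' ht' htt
    have h1 : 0 < min (δ t) (δ t') := lt_min (hδ t) (hδ t')
    have a1 := min_le_left (δ t) (δ t')
    have a2 := min_le_right (δ t) (δ t')
    have e1 : f (t', -(δ t' / 2)) = f (t', -(min (δ t) (δ t') / 2)) :=
      eq_on_lower_box (hbox t' ht') hf (by simpa using hδ t') (by linarith [hδ t'])
        (by linarith [hδ t']) (by simpa using hδ t') (by dsimp; linarith) (by dsimp; linarith)
    rw [e1]
    exact eq_on_lower_box (hbox t ht) hf htt (by dsimp; linarith) (by dsimp; linarith)
      (by simpa using hδ t) (by linarith [hδ t]) (by linarith [hδ t])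
  have hJ : ∀ f ∈ locConst (F ∪ axis), ∀ t t', (t, (0 : ℝ)) ∉ F → (t', (0 : ℝ)) ∉ F →
      N t = N t' → J t f = J t' f := by
    intro f hf t t' ht ht' hn
    have hu := hN t t' ht ht' hn
    refine eq_of_isPreconnected_of_eventually (f := fun t => J t f) (s := uIcc t t')
      (convex_uIcc t t').isPreconnected (fun s hs => ?_) left_mem_uIcc right_mem_uIcc
    have hc : ContinuousAt (fun r : ℝ => (r, (0 : ℝ))) s := by fun_prop
    have hev := hc.eventually (hF.isOpen_compl.mem_nhds (hu s hs))
    filter_upwards [hev, Metric.ball_mem_nhds s (hδ s)] with r hr hr2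
    rw [Metric.mem_ball, Real.dist_eq] at hr2
    simp only [J]
    rw [up f hf s (hu s hs) r hr hr2, down f hf s (hu s hs) r hr hr2]
  -- the jump map
  let φ : locConst (F ∪ axis) →ₗ[ZMod 2] (Fin M → ZMod 2) :=
    -- One coordinate per gap, read at an arbitrary abscissa of the gap; indices of no gap get 0.
    { toFun := fun f k => if h : ∃ t, (t, (0 : ℝ)) ∉ F ∧ N t = k then J h.choose f else 0
      map_add' := by
        intro f g
        ext k
        by_cases h : ∃ t, (t, (0 : ℝ)) ∉ F ∧ N t = k
        · simp only [h, dif_pos, J, Submodule.coe_add, Pi.add_apply]; ring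
        · simp [h]
      map_smul' := by
        intro c f
        ext k
        by_cases h : ∃ t, (t, (0 : ℝ)) ∉ F ∧ N t = k
        · simp only [h, dif_pos, J, Submodule.coe_smul, Pi.smul_apply, smul_eq_mul,
            RingHom.id_apply]; ring
        · simp [h] }
  have hker : ∀ f : locConst (F ∪ axis), φ f = 0 → ∀ t, (t, (0 : ℝ)) ∉ F → J t f = 0 := by
    intro f hf t ht
    have h : ∃ s, (s, (0 : ℝ)) ∉ F ∧ N s = N t := ⟨t, ht, rfl⟩
    have := congrFun hf (N t)
    simp only [φ, LinearMap.coe_mk, AddHom.coe_mk, h, dif_pos, Pi.zero_apply] at this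
    rw [← this]
    exact hJ f f.2 _ _ ht h.choose_spec.1 h.choose_spec.2.symm
  -- the restriction map
  let ρ : locConst F →ₗ[ZMod 2] locConst (F ∪ axis) :=
    { toFun := fun f => ⟨axisᶜ.indicator f, by
        refine ⟨fun z hz => ?_, fun z hz => ?_⟩
        · rw [mem_union, not_or] at hz
          filter_upwards [f.2.1 z hz.1, isClosed_axis.isOpen_compl.mem_nhds hz.2] with w h1 h2
          rw [indicator_of_mem h2, indicator_of_mem (show z ∈ axisᶜ from hz.2), h1]
        · by_cases h : z ∈ axis
          · exact indicator_of_notMem (by simpa using h) _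
          · rw [indicator_of_mem (show z ∈ axisᶜ from h)]
            exact f.2.2 z (hz.resolve_right h)⟩
      map_add' := by
        intro f g
        exact Subtype.ext (indicator_add _ _ _)
      map_smul' := by
        intro c f
        exact Subtype.ext (indicator_const_smul _ c _) }
  have hle : LinearMap.ker φ ≤ LinearMap.range ρ := by
    intro f hf
    have hj := hker f (LinearMap.mem_ker.1 hf)
    -- The extension across the axis borrows its value there from just above; since the jump is
    -- zero, it also agrees with the value just below.
    let e : ℝ × ℝ → ZMod 2 := fun z =>
      if z ∈ F then 0 else if z.2 = 0 then f.1 (z.1, δ z.1 / 2) else f.1 z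
    have he : e ∈ locConst F := by
      refine ⟨fun z hz => ?_, fun z hz => by simp [e, hz]⟩
      have hFz := hF.isOpen_compl.mem_nhds hz
      by_cases h0 : z.2 = 0
      · obtain ⟨t, y⟩ := z
        obtain rfl : y = 0 := h0
        have hev : ∀ᶠ w : ℝ × ℝ in 𝓝 (t, 0), |w.1 - t| < δ t ∧ |w.2| < δ t := by
          have c1 : ContinuousAt (fun w : ℝ × ℝ => |w.1 - t|) (t, 0) := by fun_prop
          have c2 : ContinuousAt (fun w : ℝ × ℝ => |w.2|) (t, 0) := by fun_prop
          exact (c1.eventually_lt_const (by simpa using hδ t)).and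
            (c2.eventually_lt_const (by simpa using hδ t))
        filter_upwards [hFz, hev] with w hw hw'
        have hw2 := abs_lt.1 hw'.2
        have hwF : w ∉ F := hw
        have hd := hδ t
        simp only [e, hwF, hz, if_false, if_true]
        rcases lt_trichotomy w.2 0 with h | h | h
        · rw [if_neg h.ne]
          have : f.1 w = f.1 (t, -(δ t / 2)) :=
            eq_on_lower_box (hbox t hz) f.2 hw'.1 h hw2.1 (by simpa using hd)
              (by dsimp; linarith) (by dsimp; linarith)
          rw [this]
          exact (sub_eq_zero.1 (hj t hz)).symm
        · rw [if_pos h]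
          refine up f.1 f.2 t hz w.1 ?_ hw'.1
          rw [← h]; exact hw
        · rw [if_neg h.ne']
          exact eq_on_upper_box (hbox t hz) f.2 hw'.1 h hw2.2 (by simpa using hd)
              (by dsimp; linarith) (by dsimp; linarith)
      · have hz' : z ∉ F ∪ axis := by
          rw [mem_union, not_or]; exact ⟨hz, h0⟩
        filter_upwards [hFz, isClosed_axis.isOpen_compl.mem_nhds (show z ∈ axisᶜ from h0),
          f.2.1 z hz'] with w h1 h2 h3
        have h1' : w ∉ F := h1
        have h2' : w.2 ≠ 0 := h2
        simp only [e, h1', h2', hz, h0, if_false, h3]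
    refine ⟨⟨e, he⟩, Subtype.ext ?_⟩
    ext z
    change axisᶜ.indicator e z = f.1 z
    by_cases h : z ∈ axis
    · rw [indicator_of_notMem (by simpa using h), f.2.2 z (Or.inr h)]
    · rw [indicator_of_mem (show z ∈ axisᶜ from h)]
      have h' : z.2 ≠ 0 := h
      by_cases hz : z ∈ F
      · simp [e, hz, f.2.2 z (Or.inl hz)]
      · simp [e, hz, h']
  calc Module.rank (ZMod 2) (locConst (F ∪ axis))
      = Module.rank (ZMod 2) (LinearMap.range φ) + Module.rank (ZMod 2) (LinearMap.ker φ) :=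
        (LinearMap.rank_range_add_rank_ker φ).symm
    _ ≤ M + Module.rank (ZMod 2) (locConst F) := by
        gcongr
        · exact (Submodule.rank_le _).trans_eq (by simp)
        · exact (Submodule.rank_mono hle).trans (rank_range_le ρ)
    _ = _ := add_comm _ _

/-- The complement of the union of `m` order-connected sets has at most `m + 1` gaps. -/
theorem exists_gap_index {m : ℕ} (C : Fin m → Set ℝ) (hC : ∀ j, (C j).OrdConnected) :
    ∃ N : ℝ → Fin (m + 1), ∀ t t', t ∉ ⋃ j, C j → t' ∉ ⋃ j, C j → N t = N t' →
      ∀ s ∈ uIcc t t', s ∉ ⋃ j, C j := by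
  classical
  -- A gap is indexed by the number of sets having a point to its left. These collections grow with
  -- t, so equal cardinality forces equality, and a set met between t and t' would then have points
  -- on both sides of t.
  let A : ℝ → Finset (Fin m) := fun t => {j | ∃ c ∈ C j, c < t}
  have hA : ∀ t, (A t).card < m + 1 := fun t => by
    have := Finset.card_le_univ (A t)
    rw [Fintype.card_fin] at this
    omega
  have hmono : ∀ t t', t ≤ t' → A t ⊆ A t' := by
    intro t t' h j hj
    simp only [A, Finset.mem_filter, Finset.mem_univ, true_and] at hj ⊢
    obtain ⟨c, hc, hct⟩ := hj
    exact ⟨c, hc, hct.trans_le h⟩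
  have key : ∀ t t', t ≤ t' → t ∉ ⋃ j, C j → t' ∉ ⋃ j, C j → (A t).card = (A t').card →
      ∀ s ∈ Icc t t', s ∉ ⋃ j, C j := by
    intro t t' h ht ht' hc s hs hsC
    have hAA := Finset.eq_of_subset_of_card_le (hmono t t' h) hc.ge
    obtain ⟨j, hj⟩ := mem_iUnion.1 hsC
    have hst : s ≠ t' := fun h => ht' (h ▸ hsC)
    have h1 : j ∈ A t' := by
      simp only [A, Finset.mem_filter, Finset.mem_univ, true_and]
      exact ⟨s, hj, lt_of_le_of_ne hs.2 hst⟩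
    rw [← hAA] at h1
    simp only [A, Finset.mem_filter, Finset.mem_univ, true_and] at h1
    obtain ⟨c, hc, hct⟩ := h1
    exact ht (mem_iUnion.2 ⟨j, (hC j).out hc hj ⟨hct.le, hs.1⟩⟩)
  refine ⟨fun t => ⟨(A t).card, hA t⟩, fun t t' ht ht' h => ?_⟩
  have h' : (A t).card = (A t').card := congrArg Fin.val h
  rcases le_total t t' with hle | hle
  · rw [uIcc_of_le hle]; exact key t t' hle ht ht' h'
  · rw [uIcc_of_ge hle]; exact key t' t hle ht' ht h'.symm

/-! ### Staircases and the upper bound. -/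

/-- A set is a staircase with `d` arms if it is a union of `d` convex sets and some homeomorphism
of the plane maps it to the axis, carrying convex subsets of its arms to intervals. -/
def IsStaircase (d : ℕ) (S : Set (ℝ × ℝ)) : Prop :=
  ∃ Ψ : ℝ × ℝ ≃ₜ ℝ × ℝ, S = Ψ ⁻¹' axis ∧ ∃ A : Fin d → Set (ℝ × ℝ), S = ⋃ l, A l ∧
    (∀ l, Convex ℝ (A l)) ∧
    ∀ l C, Convex ℝ C → {t : ℝ | Ψ.symm (t, 0) ∈ A l ∩ C}.OrdConnected

theorem IsStaircase.isClosed {d : ℕ} {S : Set (ℝ × ℝ)} (h : IsStaircase d S) : IsClosed S := by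
  obtain ⟨Ψ, rfl, -⟩ := h
  exact isClosed_axis.preimage Ψ.continuous

theorem rank_locConst_empty_le : Module.rank (ZMod 2) (locConst ∅) ≤ 1 := by
  let ev : locConst ∅ →ₗ[ZMod 2] ZMod 2 := (LinearMap.proj (0 : ℝ × ℝ)).comp (locConst ∅).subtype
  have hev : Function.Injective ev := by
    intro f g hfg
    have hfg' : f.1 0 = g.1 0 := hfg
    have hc : ∀ f ∈ locConst ∅, ∀ z, f z = f 0 := fun f hf z =>
      eq_of_isPreconnected_of_eventually isPreconnected_univ (fun w _ => hf.1 w (by simp))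
        (mem_univ z) (mem_univ 0)
    refine Subtype.ext (funext fun z => ?_)
    rw [hc f f.2 z, hc g g.2 z, hfg']
  exact (LinearMap.rank_le_of_injective ev hev).trans_eq (Module.rank_self _)

theorem rank_locConst_iUnion_le {d n : ℕ} (S : Fin n → Set (ℝ × ℝ))
    (h : ∀ i, IsStaircase d (S i)) :
    Module.rank (ZMod 2) (locConst (⋃ i, S i)) ≤ (1 + n + d ^ 2 * n.choose 2 : ℕ) := by
  induction n with
  | zero =>
    rw [iUnion_of_empty]
    simpa using rank_locConst_empty_le
  | succ n ih =>
    have ih' := ih (fun i => S i.castSucc) (fun i => h _)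
    set F : Set (ℝ × ℝ) := ⋃ i : Fin n, S i.castSucc with hFdef
    have hF : IsClosed F := isClosed_iUnion_of_finite fun i => (h _).isClosed
    obtain ⟨Ψ, hS, A, hA, -, hAord⟩ := h (Fin.last n)
    have hch : ∀ i : Fin n, ∃ B : Fin d → Set (ℝ × ℝ), S i.castSucc = ⋃ l, B l ∧
        ∀ l, Convex ℝ (B l) := fun i => by
      obtain ⟨_, -, B, hB, hB', -⟩ := h i.castSucc
      exact ⟨B, hB, hB'⟩
    choose B hB hBc using hch
    have hun : ⋃ i, S i = Ψ ⁻¹' (Ψ.symm ⁻¹' F ∪ axis) := by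
      rw [preimage_union, ← hS, ← preimage_comp]
      ext z
      simp only [mem_iUnion, mem_union, Fin.exists_fin_succ', hFdef]
      simp
    let e := Fintype.equivFin (Fin n × Fin d × Fin d)
    -- The trace on the straightened curve of one of its arms meeting one arm of an earlier curve.
    let C : Fin n × Fin d × Fin d → Set ℝ := fun q =>
      {t | Ψ.symm (t, 0) ∈ A q.2.1 ∩ B q.1 q.2.2}
    obtain ⟨N, hN⟩ := exists_gap_index (fun j => C (e.symm j)) fun j => hAord _ _ (hBc _ _)
    have hE : ∀ t, t ∈ ⋃ j, C (e.symm j) ↔ (t, (0 : ℝ)) ∈ Ψ.symm ⁻¹' F := by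
      intro t
      have h1 : Ψ.symm (t, 0) ∈ S (Fin.last n) := by
        rw [hS]; simp [axis]
      rw [e.symm.surjective.iUnion_comp C]
      rw [hA] at h1
      simp only [mem_iUnion, C, mem_ofPred_eq, mem_inter_iff, mem_preimage, hFdef, hB,
        Prod.exists] at h1 ⊢
      obtain ⟨l, hl⟩ := h1
      exact ⟨fun ⟨i, k, l, _, h2⟩ => ⟨i, l, h2⟩, fun ⟨i, k, h2⟩ => ⟨i, l, k, hl, h2⟩⟩
    have hstep := rank_locConst_union_axis_le (hF.preimage Ψ.symm.continuous) N (by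
      intro t t' ht ht' hn s hs
      rw [← hE] at ht ht' ⊢
      exact hN t t' ht ht' hn s hs)
    rw [hun, rank_locConst_preimage]
    rw [rank_locConst_preimage] at hstep
    refine hstep.trans ((add_le_add_left ih' _).trans ?_)
    rw [← Nat.cast_add, Nat.cast_le]
    simp only [Fintype.card_prod, Fintype.card_fin]
    rw [Nat.choose_succ_succ', Nat.choose_one_right]
    nlinarith

/-! ### Z's and W's are staircases. -/

theorem det_ne_zero_of_linearIndependent {a b : ℝ × ℝ} (h : LinearIndependent ℝ ![a, b]) :
    a.1 * b.2 - a.2 * b.1 ≠ 0 := by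
  rw [LinearIndependent.pair_iff] at h
  intro hD
  obtain ⟨h1, h2⟩ := h b.2 (-a.2) (by ext <;> simp <;> linarith)
  obtain ⟨h3, h4⟩ := h b.1 (-a.1) (by ext <;> simp <;> linarith)
  obtain ⟨h5, -⟩ := h 1 0 (by ext <;> simp <;> linarith)
  exact one_ne_zero h5

/-- A curve that is monotone in the coordinates with respect to a basis `a, b` and affine on each
of `d` intervals is a staircase. -/
theorem isStaircase_of_curve {d : ℕ} {p a b : ℝ × ℝ} (hab : LinearIndependent ℝ ![a, b])
    {v : ℝ → ℝ} (hv : Continuous v) {I : Fin d → Set ℝ} (hI : ∀ l, Convex ℝ (I l))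
    (hun : ⋃ l, I l = univ) {c e : Fin d → ℝ} (hvI : ∀ l, ∀ t ∈ I l, v t = c l + e l * t) :
    IsStaircase d (⋃ l, (fun t => p + (t - v t) • a + v t • b) '' I l) := by
  have hD := det_ne_zero_of_linearIndependent hab
  set D := a.1 * b.2 - a.2 * b.1 with hDdef
  -- Coordinates with origin p in the basis a, b, by Cramer's rule.
  let U : ℝ × ℝ → ℝ := fun z => ((z.1 - p.1) * b.2 - (z.2 - p.2) * b.1) / D
  let V : ℝ × ℝ → ℝ := fun z => (a.1 * (z.2 - p.2) - a.2 * (z.1 - p.1)) / D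
  have hU : Continuous U := by fun_prop
  have hV : Continuous V := by fun_prop
  have hUV : ∀ z : ℝ × ℝ, p + U z • a + V z • b = z := by
    intro z
    ext
    · simp only [U, V, Prod.fst_add, Prod.smul_fst, smul_eq_mul]
      field_simp
      rw [hDdef]; ring
    · simp only [U, V, Prod.snd_add, Prod.smul_snd, smul_eq_mul]
      field_simp
      rw [hDdef]; ring
  have hU' : ∀ x y : ℝ, U (p + x • a + y • b) = x := by
    intro x y
    simp only [U, Prod.snd_add, Prod.smul_snd, Prod.fst_add, Prod.smul_fst, smul_eq_mul]
    rw [div_eq_iff hD, hDdef]; ring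
  have hV' : ∀ x y : ℝ, V (p + x • a + y • b) = y := by
    intro x y
    simp only [V, Prod.snd_add, Prod.smul_snd, Prod.fst_add, Prod.smul_fst, smul_eq_mul]
    rw [div_eq_iff hD, hDdef]; ring
  let γ : ℝ → ℝ × ℝ := fun t => p + (t - v t) • a + v t • b
  -- On the curve U + V = t and V = v t; the shear by v over U + V straightens it.
  let Ψ : ℝ × ℝ ≃ₜ ℝ × ℝ :=
    { toFun := fun z => (U z + V z, V z - v (U z + V z))
      invFun := fun w => p + (w.1 - (w.2 + v w.1)) • a + (w.2 + v w.1) • b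
      left_inv := by
        intro z
        simp only [sub_add_cancel, add_sub_cancel_right]
        exact hUV z
      right_inv := by
        intro w
        simp only [hU', hV', sub_add_cancel, add_sub_cancel_right]
      continuous_toFun := by fun_prop
      continuous_invFun := by fun_prop }
  have hΨγ : ∀ t, Ψ.symm (t, 0) = γ t := by
    intro t
    change p + (t - (0 + v t)) • a + (0 + v t) • b = γ t
    simp [γ]
  have hγinj : Function.Injective γ := by
    intro s t hst
    rw [← hΨγ, ← hΨγ] at hst
    simpa using Ψ.symm.injective hst
  have hline : ∀ l, ∃ f : ℝ →ᵃ[ℝ] ℝ × ℝ, ∀ t ∈ I l, γ t = f t := by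
    intro l
    let q := p - c l • a + c l • b
    let w := (1 - e l) • a + e l • b
    refine ⟨AffineMap.lineMap q (q + w), fun t ht => ?_⟩
    simp only [γ, hvI l t ht, AffineMap.lineMap_apply, vsub_eq_sub, vadd_eq_add, q, w]
    module
  refine ⟨Ψ, ?_, fun l => γ '' I l, rfl, fun l => ?_, fun l C hC => ?_⟩
  · rw [← image_iUnion, hun, image_univ]
    ext z
    constructor
    · rintro ⟨t, rfl⟩
      change Ψ (γ t) ∈ axis
      rw [← hΨγ]
      simp [axis]
    · intro hz
      refine ⟨(Ψ z).1, ?_⟩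
      have : Ψ z = ((Ψ z).1, 0) := Prod.ext rfl hz
      change γ _ = z
      rw [← hΨγ, ← this]
      simp
  · obtain ⟨f, hf⟩ := hline l
    change Convex ℝ (γ '' I l)
    rw [image_congr hf]
    exact (hI l).affine_image f
  · obtain ⟨f, hf⟩ := hline l
    have : {t | Ψ.symm (t, 0) ∈ γ '' I l ∩ C} = I l ∩ f ⁻¹' C := by
      ext t
      simp only [mem_ofPred_eq, hΨγ, mem_inter_iff, hγinj.mem_set_image, mem_preimage]
      exact and_congr_right fun ht => by rw [hf t ht]
    rw [this]
    exact ((hI l).inter (hC.affine_preimage f)).ordConnected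

theorem segment_add_right (p b : ℝ × ℝ) :
    segment ℝ p (p + b) = (fun θ : ℝ => p + θ • b) '' Icc 0 1 := by
  rw [segment_eq_image']
  simp

theorem IsLongLeggedZ.isStaircase {S : Set (ℝ × ℝ)} (h : IsLongLeggedZ S) : IsStaircase 3 S := by
  obtain ⟨p, a, b, hab, rfl⟩ := h
  -- The b-coordinate at time t: it rises from 0 to 1 on the middle arm and is constant on the
  -- others.
  have hv : Continuous fun t : ℝ => max 0 (min t 1) := by fun_prop
  have key := isStaircase_of_curve (p := p) hab hv (I := ![Iic 0, Icc 0 1, Ici 1])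
    (c := ![0, 0, 1]) (e := ![0, 1, 0])
    (by simp [Fin.forall_fin_succ, convex_Iic, convex_Icc, convex_Ici])
    (by
      refine eq_univ_of_forall fun t => mem_iUnion.2 ?_
      rcases le_total t 0 with h | h
      · exact ⟨0, h⟩
      rcases le_total t 1 with h' | h'
      · exact ⟨1, h, h'⟩
      · exact ⟨2, h'⟩)
    (by
      simp only [Fin.forall_fin_succ, Matrix.cons_val_zero, Matrix.cons_val_succ, mem_Iic, mem_Icc,
        mem_Ici]
      refine ⟨fun t ht => ?_, fun t ht => ?_, fun t ht => ?_, fun i => i.elim0⟩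
      · rw [min_eq_left (by linarith), max_eq_left ht]; ring
      · rw [min_eq_left ht.2, max_eq_right ht.1]; ring
      · rw [min_eq_right ht, max_eq_right zero_le_one]; ring)
  convert key using 1
  rw [segment_add_right]
  ext z
  simp only [mem_union, mem_iUnion, Fin.exists_fin_succ, Matrix.cons_val_zero,
    Matrix.cons_val_succ, halfLine, mem_ofPred_eq, mem_image, mem_Iic, mem_Icc, mem_Ici,
    IsEmpty.exists_iff, or_false, or_assoc]
  refine or_congr ⟨?_, ?_⟩ (or_congr ⟨?_, ?_⟩ ⟨?_, ?_⟩)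
  · rintro ⟨t, ht, rfl⟩
    refine ⟨-t, by linarith, ?_⟩
    rw [min_eq_left (by linarith), max_eq_left (by linarith)]; module
  · rintro ⟨t, ht, rfl⟩
    refine ⟨-t, by linarith, ?_⟩
    rw [min_eq_left (by linarith), max_eq_left (by linarith)]; module
  · rintro ⟨t, ht, rfl⟩
    refine ⟨t, ht, ?_⟩
    rw [min_eq_left ht.2, max_eq_right ht.1]; module
  · rintro ⟨t, ht, rfl⟩
    refine ⟨t, ht, ?_⟩
    rw [min_eq_left ht.2, max_eq_right ht.1]; module
  · rintro ⟨t, ht, rfl⟩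
    refine ⟨t + 1, by linarith, ?_⟩
    rw [min_eq_right (by linarith), max_eq_right zero_le_one]; module
  · rintro ⟨t, ht, rfl⟩
    refine ⟨t - 1, by linarith, ?_⟩
    rw [min_eq_right (by linarith), max_eq_right zero_le_one]; module

theorem IsLongLeggedW.isStaircase {S : Set (ℝ × ℝ)} (h : IsLongLeggedW S) : IsStaircase 4 S := by
  obtain ⟨p, a, b, hab, rfl⟩ := h
  -- The b-coordinate rises on [0, 1] and again from time 2 on; on the other two arms the
  -- a-coordinate rises.
  have hv : Continuous fun t : ℝ => max 0 (min t 1) + max 0 (t - 2) := by fun_prop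
  have key := isStaircase_of_curve (p := p) hab hv (I := ![Iic 0, Icc 0 1, Icc 1 2, Ici 2])
    (c := ![0, 0, 1, -1]) (e := ![0, 1, 0, 1])
    (by simp [Fin.forall_fin_succ, convex_Iic, convex_Icc, convex_Ici])
    (by
      refine eq_univ_of_forall fun t => mem_iUnion.2 ?_
      rcases le_total t 0 with h | h
      · exact ⟨0, h⟩
      rcases le_total t 1 with h' | h'
      · exact ⟨1, h, h'⟩
      rcases le_total t 2 with h'' | h''
      · exact ⟨2, h', h''⟩
      · exact ⟨3, h''⟩)
    (by
      simp only [Fin.forall_fin_succ, Matrix.cons_val_zero, Matrix.cons_val_succ, mem_Iic, mem_Icc,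
        mem_Ici]
      refine ⟨fun t ht => ?_, fun t ht => ?_, fun t ht => ?_, fun t ht => ?_, fun i => i.elim0⟩
      · rw [min_eq_left (by linarith), max_eq_left ht, max_eq_left (by linarith)]; ring
      · rw [min_eq_left ht.2, max_eq_right ht.1, max_eq_left (by linarith)]; ring
      · rw [min_eq_right ht.1, max_eq_right zero_le_one, max_eq_left (by linarith)]; ring
      · rw [min_eq_right (by linarith), max_eq_right zero_le_one, max_eq_right (by linarith)]; ring)
  convert key using 1
  rw [segment_add_right, segment_add_right]
  ext z
  simp only [mem_union, mem_iUnion, Fin.exists_fin_succ, Matrix.cons_val_zero,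
    Matrix.cons_val_succ, halfLine, mem_ofPred_eq, mem_image, mem_Iic, mem_Icc, mem_Ici,
    IsEmpty.exists_iff, or_false, or_assoc]
  refine or_congr ⟨?_, ?_⟩ (or_congr ⟨?_, ?_⟩ (or_congr ⟨?_, ?_⟩ ⟨?_, ?_⟩))
  · rintro ⟨t, ht, rfl⟩
    refine ⟨-t, by linarith, ?_⟩
    rw [min_eq_left (by linarith), max_eq_left (by linarith), max_eq_left (by linarith)]; module
  · rintro ⟨t, ht, rfl⟩
    refine ⟨-t, by linarith, ?_⟩
    rw [min_eq_left (by linarith), max_eq_left (by linarith), max_eq_left (by linarith)]; module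
  · rintro ⟨t, ht, rfl⟩
    refine ⟨t, ht, ?_⟩
    rw [min_eq_left ht.2, max_eq_right ht.1, max_eq_left (by linarith [ht.2])]; module
  · rintro ⟨t, ht, rfl⟩
    refine ⟨t, ht, ?_⟩
    rw [min_eq_left ht.2, max_eq_right ht.1, max_eq_left (by linarith [ht.2])]; module
  · rintro ⟨t, ht, rfl⟩
    refine ⟨t + 1, ⟨by linarith [ht.1], by linarith [ht.2]⟩, ?_⟩
    rw [min_eq_right (by linarith [ht.1]), max_eq_right zero_le_one,
      max_eq_left (by linarith [ht.2])]
    module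
  · rintro ⟨t, ht, rfl⟩
    refine ⟨t - 1, ⟨by linarith [ht.1], by linarith [ht.2]⟩, ?_⟩
    rw [min_eq_right (by linarith [ht.1]), max_eq_right zero_le_one,
      max_eq_left (by linarith [ht.2])]
    module
  · rintro ⟨t, ht, rfl⟩
    refine ⟨t + 2, by linarith, ?_⟩
    rw [min_eq_right (by linarith), max_eq_right zero_le_one, max_eq_right (by linarith)]; module
  · rintro ⟨t, ht, rfl⟩
    refine ⟨t - 2, by linarith, ?_⟩
    rw [min_eq_right (by linarith), max_eq_right zero_le_one, max_eq_right (by linarith)]; module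

theorem encard_regions_iUnion_le {d n : ℕ} (S : Fin n → Set (ℝ × ℝ))
    (h : ∀ i, IsStaircase d (S i)) :
    (regions (⋃ i, S i)).encard ≤ (1 + n + d ^ 2 * n.choose 2 : ℕ) :=
  encard_regions_le (isClosed_iUnion_of_finite fun i => (h i).isClosed)
    (rank_locConst_iUnion_le S h)

/-! ### M's are W's. -/

theorem linearIndependent_pair_of_det_ne_zero {a b : ℝ × ℝ} (h : a.1 * b.2 - a.2 * b.1 ≠ 0) :
    LinearIndependent ℝ ![a, b] := by
  rw [LinearIndependent.pair_iff]
  intro s t hst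
  have h1 : s * a.1 + t * b.1 = 0 := by simpa using congrArg Prod.fst hst
  have h2 : s * a.2 + t * b.2 = 0 := by simpa using congrArg Prod.snd hst
  constructor
  · refine (mul_eq_zero.1 (?_ : s * (a.1 * b.2 - a.2 * b.1) = 0)).resolve_right h
    linear_combination b.2 * h1 - b.1 * h2
  · refine (mul_eq_zero.1 (?_ : t * (a.1 * b.2 - a.2 * b.1) = 0)).resolve_right h
    linear_combination a.1 * h2 - a.2 * h1

theorem IsLongLeggedW.reflect {S : Set (ℝ × ℝ)} (h : IsLongLeggedW S) :
    IsLongLeggedW ((fun x : ℝ × ℝ => (x.1, -x.2)) '' S) := by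
  obtain ⟨p, a, b, hab, rfl⟩ := h
  let r : ℝ × ℝ →ₗ[ℝ] ℝ × ℝ := LinearMap.prodMap LinearMap.id (-LinearMap.id)
  have hr : (fun x : ℝ × ℝ => (x.1, -x.2)) = r := by ext <;> simp [r]
  have hhalf : ∀ q d : ℝ × ℝ, r '' halfLine q d = halfLine (r q) (r d) := by
    intro q d
    ext z
    constructor
    · rintro ⟨_, ⟨t, ht, rfl⟩, rfl⟩
      exact ⟨t, ht, by simp⟩
    · rintro ⟨t, ht, rfl⟩
      exact ⟨_, ⟨t, ht, rfl⟩, by simp⟩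
  have hseg : ∀ x y : ℝ × ℝ, r '' segment ℝ x y = segment ℝ (r x) (r y) := fun x y =>
    image_segment ℝ r.toAffineMap x y
  refine ⟨r p, r a, r b, ?_, ?_⟩
  · apply linearIndependent_pair_of_det_ne_zero
    have := det_ne_zero_of_linearIndependent hab
    intro h
    apply this
    simp only [r, LinearMap.prodMap_apply, LinearMap.id_apply, LinearMap.neg_apply] at h
    linarith
  · rw [hr, image_union, image_union, image_union, hhalf, hhalf, hseg, hseg]
    simp only [map_add, map_neg]

theorem isLongLeggedM_iff {S : Set (ℝ × ℝ)} : IsLongLeggedM S ↔ IsLongLeggedW S := by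
  constructor
  · rintro ⟨W, hW, rfl⟩
    exact hW.reflect
  · intro h
    refine ⟨_, h.reflect, ?_⟩
    simp [image_image]

/-! ### Half-planes, steps and local probes. -/

/-- The indicator of the points below the graph of `ℓ`. -/
noncomputable def below (ℓ : ℝ → ℝ) (z : ℝ × ℝ) : ZMod 2 := if z.2 < ℓ z.1 then 1 else 0

/-- The indicator of the half-line `[s, ∞)`. -/
noncomputable def stepFrom (s x : ℝ) : ZMod 2 := if s ≤ x then 1 else 0

theorem eventually_below_eq {ℓ : ℝ → ℝ} (hℓ : Continuous ℓ) {z : ℝ × ℝ} (hz : z.2 ≠ ℓ z.1) :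
    ∀ᶠ w in 𝓝 z, below ℓ w = below ℓ z := by
  have h1 : ContinuousAt (fun w : ℝ × ℝ => w.2) z := by fun_prop
  have h2 : ContinuousAt (fun w : ℝ × ℝ => ℓ w.1) z := by fun_prop
  rcases lt_or_gt_of_ne hz with h | h
  · filter_upwards [h1.eventually_lt h2 h] with w hw
    simp [below, h, hw]
  · filter_upwards [h2.eventually_lt h1 h] with w hw
    simp [below, not_lt.2 h.le, not_lt.2 hw.le]

theorem eventually_stepFrom_eq {s x : ℝ} (h : s ≠ x) :
    ∀ᶠ y in 𝓝 x, stepFrom s y = stepFrom s x := by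
  rcases lt_or_gt_of_ne h with h | h
  · filter_upwards [lt_mem_nhds h] with y hy
    simp [stepFrom, h.le, hy.le]
  · filter_upwards [gt_mem_nhds h] with y hy
    simp [stepFrom, not_le.2 h, not_le.2 hy]

/-- `Probe z u h a` says that `a` is the sum of the values of `h` at points close to `z` in the
directions `u j`. -/
def Probe (z : ℝ × ℝ) {r : ℕ} (u : Fin r → ℝ × ℝ) (h : ℝ × ℝ → ZMod 2) (a : ZMod 2) : Prop :=
  ∀ᶠ δ in 𝓝[>] (0 : ℝ), ∑ j, h (z + δ • u j) = a

theorem tendsto_probe (z u : ℝ × ℝ) : Tendsto (fun δ : ℝ => z + δ • u) (𝓝[>] 0) (𝓝 z) := by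
  have h : Continuous fun δ : ℝ => z + δ • u := by fun_prop
  have := h.tendsto 0
  simp only [zero_smul, add_zero] at this
  exact this.mono_left nhdsWithin_le_nhds

theorem add_smul_below_line_iff {z : ℝ × ℝ} {m q δ : ℝ} (hz : z.2 = m * z.1 + q) (hδ : 0 < δ)
    (u : ℝ × ℝ) : (z + δ • u).2 < m * (z + δ • u).1 + q ↔ u.2 < m * u.1 := by
  have : m * (z + δ • u).1 + q - (z + δ • u).2 = δ * (m * u.1 - u.2) := by
    simp only [Prod.snd_add, Prod.fst_add, Prod.smul_snd, Prod.smul_fst, smul_eq_mul, hz]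
    ring
  rw [← sub_pos, this, mul_pos_iff_of_pos_left hδ, sub_pos]

namespace Probe

variable {z : ℝ × ℝ} {r : ℕ} {u : Fin r → ℝ × ℝ} {h h' : ℝ × ℝ → ZMod 2} {a a' : ZMod 2}

theorem unique (h1 : Probe z u h a) (h2 : Probe z u h a') : a = a' := by
  obtain ⟨δ, h3, h4⟩ := (h1.and h2).exists
  exact h3.symm.trans h4

theorem congr (h1 : Probe z u h a) (hh : ∀ᶠ w in 𝓝 z, h' w = h w) : Probe z u h' a := by
  have : ∀ᶠ δ in 𝓝[>] (0 : ℝ), ∀ j, h' (z + δ • u j) = h (z + δ • u j) :=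
    eventually_all.2 fun j => (tendsto_probe z (u j)).eventually hh
  filter_upwards [h1, this] with δ h2 h3
  rw [← h2]
  exact Finset.sum_congr rfl fun j _ => h3 j

theorem add (h1 : Probe z u h a) (h2 : Probe z u h' a') :
    Probe z u (fun w => h w + h' w) (a + a') := by
  filter_upwards [h1, h2] with δ h3 h4
  rw [Finset.sum_add_distrib, h3, h4]

theorem mul_left (c : ZMod 2) (h1 : Probe z u h a) : Probe z u (fun w => c * h w) (c * a) := by
  filter_upwards [h1] with δ h3
  rw [← Finset.mul_sum, h3]

theorem sum {κ : Type*} {s : Finset κ} {f : κ → ℝ × ℝ → ZMod 2} {b : κ → ZMod 2}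
    (hf : ∀ k ∈ s, Probe z u (f k) (b k)) :
    Probe z u (fun w => ∑ k ∈ s, f k w) (∑ k ∈ s, b k) := by
  have : ∀ᶠ δ in 𝓝[>] (0 : ℝ), ∀ k ∈ s, ∑ j, f k (z + δ • u j) = b k :=
    (Filter.eventually_all_finset s).2 hf
  filter_upwards [this] with δ h3
  rw [Finset.sum_comm]
  exact Finset.sum_congr rfl h3

theorem const (hr : (r : ZMod 2) = 0) (c : ZMod 2) : Probe z u (fun _ => c) 0 := by
  refine Eventually.of_forall fun δ => ?_
  simp [hr]

theorem below_line {m q : ℝ} (hz : z.2 = m * z.1 + q) :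
    Probe z u (below fun x => m * x + q) (∑ j, if (u j).2 < m * (u j).1 then 1 else 0) := by
  filter_upwards [self_mem_nhdsWithin] with δ hδ
  exact Finset.sum_congr rfl fun j _ => if_congr (add_smul_below_line_iff hz hδ _) rfl rfl

theorem stepFrom_mul_below_line {m q : ℝ} (hz : z.2 = m * z.1 + q) :
    Probe z u (fun w => stepFrom z.1 w.1 * below (fun x => m * x + q) w)
      (∑ j, if 0 ≤ (u j).1 ∧ (u j).2 < m * (u j).1 then 1 else 0) := by
  filter_upwards [self_mem_nhdsWithin] with δ hδ
  refine Finset.sum_congr rfl fun j _ => ?_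
  have h2 : z.1 ≤ (z + δ • u j).1 ↔ 0 ≤ (u j).1 := by
    simp only [Prod.fst_add, Prod.smul_fst, smul_eq_mul, le_add_iff_nonneg_right]
    exact mul_nonneg_iff_of_pos_left hδ
  rw [below, stepFrom, if_congr h2 rfl rfl, if_congr (add_smul_below_line_iff hz hδ _) rfl rfl,
    ite_and]
  split_ifs <;> simp

end Probe

/-! ### The lower bound from simple crossings. -/

/-- A way of tracing a curve whose `d` arms are graphs over the closed sets `dom k`, all of which
contain the strip `|x| < 1`: `full k` is the part of the arm `k` in the whole curve, and
`tail k s k'` is the part of the arm `k'` in the half of the curve that starts on the arm `k` at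
abscissa `s`. -/
structure Profile (d : ℕ) where
  dom : Fin d → Set ℝ
  isClosed_dom : ∀ k, IsClosed (dom k)
  full : Fin d → ℝ → ZMod 2
  tail : Fin d → ℝ → Fin d → ℝ → ZMod 2
  rest : Fin d → Fin d → ZMod 2
  full_eq_zero : ∀ k, ∀ x ∉ dom k, full k x = 0
  tail_eq_zero : ∀ k, ∀ s ∈ Ioo (-1 : ℝ) 1, ∀ k', ∀ x ∉ dom k', tail k s k' x = 0
  full_strip : ∀ k, ∀ x ∈ Ioo (-1 : ℝ) 1, full k x = 1
  tail_strip : ∀ k s k', ∀ x ∈ Ioo (-1 : ℝ) 1,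
    tail k s k' x = (if k' = k then stepFrom s x else 0) + rest k k'

/-- The lines `L k` fit the profile if consecutive arms on these lines meet at the corners. -/
def Profile.Fits {d : ℕ} (P : Profile d) (L : Fin d → ℝ → ℝ) : Prop :=
  (∀ z : ℝ × ℝ, ∃ κ, ∀ᶠ x in 𝓝 z.1, ∑ k, P.full k x * below (L k) z = κ) ∧
  ∀ k, ∀ s ∈ Ioo (-1 : ℝ) 1, ∀ z : ℝ × ℝ, ∃ κ, ∀ᶠ x in 𝓝 z.1,
    ∑ k', P.tail k s k' x * below (L k') z = κ + stepFrom s x * below (L k) z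

/-- The union of the curves with arms on the lines `L (i, k)`. -/
def Profile.drawing {d : ℕ} (P : Profile d) {n : ℕ} (L : Fin n × Fin d → ℝ → ℝ) : Set (ℝ × ℝ) :=
  {z | ∃ γ, z.1 ∈ P.dom γ.2 ∧ z.2 = L γ z.1}

/-- The number of points, modulo 2, in which the upward vertical half-line from `z` meets the arms
on the lines `L k` weighted by `c`. -/
noncomputable def crossings {d : ℕ} (L : Fin d → ℝ → ℝ) (c : Fin d → ℝ → ZMod 2)
    (z : ℝ × ℝ) : ZMod 2 :=
  ∑ k, c k z.1 * below (L k) z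

/-- A `below` factor can jump at z only if z is on its line. As z is off the drawing, it is then
outside the closed domain of that arm, near which the weight vanishes. So these factors may be
frozen at z and only the weights vary. -/
theorem Profile.eventually_crossings_eq {d n : ℕ} (P : Profile d) {L : Fin n × Fin d → ℝ → ℝ}
    (hL : ∀ γ, Continuous (L γ)) {z : ℝ × ℝ} (hz : z ∉ P.drawing L) (i : Fin n)
    {c : Fin d → ℝ → ZMod 2} (hc : ∀ k, ∀ x ∉ P.dom k, c k x = 0) :
    ∀ᶠ w in 𝓝 z, crossings (fun k => L (i, k)) c w = ∑ k, c k w.1 * below (L (i, k)) z := by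
  have : ∀ᶠ w in 𝓝 z, ∀ k, c k w.1 * below (L (i, k)) w = c k w.1 * below (L (i, k)) z := by
    refine eventually_all.2 fun k => ?_
    by_cases h : z.2 = L (i, k) z.1
    · have h1 : z.1 ∉ P.dom k := fun h2 => hz ⟨(i, k), h2, h⟩
      filter_upwards [continuousAt_fst.eventually ((P.isClosed_dom k).isOpen_compl.mem_nhds h1)]
        with w hw
      rw [hc k _ hw, zero_mul, zero_mul]
    · filter_upwards [eventually_below_eq (hL (i, k)) h] with w hw
      rw [hw]
  filter_upwards [this] with w hw
  exact Finset.sum_congr rfl fun k _ => hw k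

/-- Lower bound for the number of regions of a drawing by the number of its simple crossings in
the strip `|x| < 1`. -/
theorem Profile.le_encard_regions {d n : ℕ} (P : Profile d) (k₀ : Fin d)
    (m q : Fin n × Fin d → ℝ) (L : Fin n × Fin d → ℝ → ℝ) (hL : ∀ γ, L γ = fun x => m γ * x + q γ)
    (hfit : ∀ i, P.Fits fun k => L (i, k)) {ι : Type*} [Fintype ι]
    (α β : ι → Fin n × Fin d) (X : ι → ℝ) (hX : ∀ v, X v ∈ Ioo (-1 : ℝ) 1)
    (hslope : ∀ v, m (α v) ≠ m (β v)) (hmeet : ∀ v, L (α v) (X v) = L (β v) (X v))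
    (hother : ∀ v γ, γ ≠ α v → γ ≠ β v → L γ (X v) ≠ L (α v) (X v))
    (hinj : ∀ v v', X v' = X v → L (α v') (X v) = L (α v) (X v) → v' = v)
    (hzero : ∀ i γ, γ ≠ (i, k₀) → L γ 0 ≠ L (i, k₀) 0) :
    ((1 + n + Fintype.card ι : ℕ) : ℕ∞) ≤ (regions (P.drawing L)).encard := by
  classical
  have hLc : ∀ γ, Continuous (L γ) := fun γ => by rw [hL]; fun_prop
  set F := P.drawing L with hF
  let s : Fin n → ℝ × ℝ → ZMod 2 := fun i => crossings (fun k => L (i, k)) P.full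
  let T : Fin n × Fin d → ℝ → ℝ × ℝ → ZMod 2 := fun γ x =>
    crossings (fun k => L (γ.1, k)) (P.tail γ.2 x)
  -- The two half-curves from the crossing form one curve without a loose end in the plane, so the
  -- parity can change only on F.
  let g : ι → ℝ × ℝ → ZMod 2 := fun v z => T (α v) (X v) z + T (β v) (X v) z
  -- these functions are locally constant
  have hs : ∀ i, ∀ z ∉ F, ∀ᶠ w in 𝓝 z, s i w = s i z := by
    intro i z hz
    obtain ⟨κ, hκ⟩ := (hfit i).1 z
    have h2 : ∀ᶠ w in 𝓝 z, s i w = κ := by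
      filter_upwards [P.eventually_crossings_eq hLc hz i P.full_eq_zero,
        continuousAt_fst.eventually hκ] with w h3 h4
      exact h3.trans h4
    filter_upwards [h2] with w hw
    rw [hw, h2.self_of_nhds]
  have hT : ∀ γ, ∀ x ∈ Ioo (-1 : ℝ) 1, ∀ z ∉ F, ∃ κ, ∀ᶠ w in 𝓝 z,
      T γ x w = κ + stepFrom x w.1 * below (L γ) z := by
    intro γ x hx z hz
    obtain ⟨κ, hκ⟩ := (hfit γ.1).2 γ.2 x hx z
    refine ⟨κ, ?_⟩
    filter_upwards [P.eventually_crossings_eq hLc hz γ.1 (P.tail_eq_zero γ.2 x hx),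
      continuousAt_fst.eventually hκ] with w h3 h4
    exact h3.trans h4
  have hg : ∀ v, ∀ z ∉ F, ∀ᶠ w in 𝓝 z, g v w = g v z := by
    intro v z hz
    obtain ⟨κ, hκ⟩ := hT (α v) (X v) (hX v) z hz
    obtain ⟨κ', hκ'⟩ := hT (β v) (X v) (hX v) z hz
    -- On the vertical line through the crossing both arms have the same height, so their two steps
    -- cancel.
    have h1 : ∀ᶠ w in 𝓝 z, stepFrom (X v) w.1 * (below (L (α v)) z + below (L (β v)) z) =
        stepFrom (X v) z.1 * (below (L (α v)) z + below (L (β v)) z) := by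
      by_cases h : X v = z.1
      · have : below (L (α v)) z = below (L (β v)) z := by simp only [below, ← h, hmeet v]
        rw [this, CharTwo.add_self_eq_zero]
        simp
      · filter_upwards [continuousAt_fst.eventually (eventually_stepFrom_eq h)] with w hw
        rw [hw]
    have h2 : ∀ᶠ w in 𝓝 z, g v w = κ + κ' +
        stepFrom (X v) w.1 * (below (L (α v)) z + below (L (β v)) z) := by
      filter_upwards [hκ, hκ'] with w h3 h4
      simp only [g, h3, h4]; ring
    have h3 := h2.self_of_nhds
    filter_upwards [h1, h2] with w h4 h5
    rw [h5, h3, h4]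
  -- behaviour in the strip
  have hstrip : ∀ z : ℝ × ℝ, z.1 ∈ Ioo (-1 : ℝ) 1 → ∀ᶠ w in 𝓝 z, w.1 ∈ Ioo (-1 : ℝ) 1 :=
    fun z hz => continuousAt_fst.eventually (isOpen_Ioo.mem_nhds hz)
  have hs' : ∀ i, ∀ z : ℝ × ℝ, z.1 ∈ Ioo (-1 : ℝ) 1 → ∀ᶠ w in 𝓝 z,
      s i w = ∑ k, below (L (i, k)) w := by
    intro i z hz
    filter_upwards [hstrip z hz] with w hw
    simp only [s, crossings]
    exact Finset.sum_congr rfl fun k _ => by rw [P.full_strip k _ hw, one_mul]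
  have hT' : ∀ γ x, ∀ z : ℝ × ℝ, z.1 ∈ Ioo (-1 : ℝ) 1 → ∀ᶠ w in 𝓝 z,
      T γ x w = stepFrom x w.1 * below (L γ) w +
        ∑ k, P.rest γ.2 k * below (L (γ.1, k)) w := by
    intro γ x z hz
    filter_upwards [hstrip z hz] with w hw
    simp only [T, crossings]
    simp_rw [P.tail_strip _ _ _ _ hw, add_mul, Finset.sum_add_distrib, ite_mul, zero_mul]
    simp
  -- the dual functionals at the crossings
  let z₀ : ι → ℝ × ℝ := fun v => (X v, L (α v) (X v))
  -- The mean slope puts the left and right probes strictly between the crossing lines: one probe in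
  -- each of the four sectors.
  obtain ⟨μ, hμ'⟩ : ∃ μ : ι → ℝ, ∀ v, μ v = (m (α v) + m (β v)) / 2 := ⟨_, fun _ => rfl⟩
  let u : ι → Fin 4 → ℝ × ℝ := fun v => ![(0, 1), (0, -1), (1, μ v), (-1, -μ v)]
  have hthrough : ∀ v γ, L γ (X v) = L (α v) (X v) → γ = α v ∨ γ = β v := by
    intro v γ h
    by_contra! h'
    exact hother v γ h'.1 h'.2 h
  have hμ : ∀ v γ, L γ (X v) = L (α v) (X v) → m γ ≠ μ v := by
    intro v γ h h'
    apply hslope v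
    rcases hthrough v γ h with rfl | rfl <;> rw [hμ'] at h' <;> linarith
  have hon : ∀ v γ, L γ (X v) = L (α v) (X v) → (z₀ v).2 = m γ * (z₀ v).1 + q γ := by
    intro v γ h
    simp only [z₀]
    rw [← h, hL]
  -- Exactly two of the four probes are below a line through the crossing; any other line has all of
  -- them on one side.
  have pr_below : ∀ v γ, Probe (z₀ v) (u v) (below (L γ)) 0 := by
    intro v γ
    by_cases h : L γ (X v) = L (α v) (X v)
    · have := Probe.below_line (u := u v) (hon v γ h)
      rw [← hL] at this
      convert this using 1
      have h2 := hμ v γ h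
      simp only [u, Fin.sum_univ_four, Matrix.cons_val]
      rcases lt_or_gt_of_ne h2 with h3 | h3
      · norm_num [h3, not_lt.2 h3.le]; decide
      · norm_num [h3, not_lt.2 h3.le]; decide
    · exact (Probe.const (by decide) _).congr (eventually_below_eq (hLc γ) (fun h' => h h'.symm))
  have pr_s : ∀ v i, Probe (z₀ v) (u v) (s i) 0 := by
    intro v i
    have := (Probe.sum (s := Finset.univ) fun k _ => pr_below v (i, k)).congr
      (hs' i (z₀ v) (hX v))
    simpa using this
  have pr_rest : ∀ v (γ : Fin n × Fin d), Probe (z₀ v) (u v)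
      (fun w => ∑ k, P.rest γ.2 k * below (L (γ.1, k)) w) 0 := by
    intro v γ
    have := Probe.sum (s := Finset.univ) fun k _ => (pr_below v (γ.1, k)).mul_left (P.rest γ.2 k)
    simpa using this
  have pr_step : ∀ v v', Probe (z₀ v) (u v) (fun w => stepFrom (X v') w.1 * below (L (α v')) w +
      stepFrom (X v') w.1 * below (L (β v')) w) (if v' = v then 1 else 0) := by
    intro v v'
    by_cases hv : v' = v
    · subst hv
      have h1 := Probe.stepFrom_mul_below_line (u := u v') (hon v' (α v') rfl)
      have h2 := Probe.stepFrom_mul_below_line (u := u v') (hon v' (β v') (hmeet v').symm)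
      rw [← hL] at h1 h2
      convert h1.add h2 using 1
      -- Of the three probes that are not to the left, the lower one is below both lines and
      -- cancels, the upper one is below neither, and the right one is below the steeper line only.
      simp only [u, Fin.sum_univ_four, Matrix.cons_val, if_true]
      rcases lt_or_gt_of_ne (hslope v') with h3 | h3
      · have h4 : ¬ μ v' < m (α v') := by rw [hμ']; linarith
        have h5 : μ v' < m (β v') := by rw [hμ']; linarith
        norm_num [h4, h5]
        decide
      · have h4 : μ v' < m (α v') := by rw [hμ']; linarith
        have h5 : ¬ μ v' < m (β v') := by rw [hμ']; linarith
        norm_num [h4, h5]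
        decide
    · rw [if_neg hv]
      by_cases hXv : X v' = X v
      -- Another crossing on the same vertical line: its two lines agree in height there, so the
      -- steps cancel near the probed point.
      · have h1 : L (α v') (X v) ≠ L (α v) (X v) := fun h => hv (hinj v v' hXv h)
        have h2 : L (β v') (X v) = L (α v') (X v) := by rw [← hXv]; exact (hmeet v').symm
        have h3 : below (L (α v')) (z₀ v) = below (L (β v')) (z₀ v) := by
          simp only [below, z₀, h2]
        refine (Probe.const (by decide) 0).congr ?_
        filter_upwards [eventually_below_eq (hLc (α v')) (z := z₀ v) h1.symm,
          eventually_below_eq (hLc (β v')) (z := z₀ v) (by simpa only [z₀, h2] using h1.symm)]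
          with w h4 h5
        rw [h4, h5, h3, CharTwo.add_self_eq_zero]
      · have h1 := ((pr_below v (α v')).add (pr_below v (β v'))).mul_left (stepFrom (X v') (X v))
        rw [add_zero, mul_zero] at h1
        refine h1.congr ?_
        have : ContinuousAt Prod.fst (z₀ v) := continuousAt_fst
        filter_upwards [this.eventually (eventually_stepFrom_eq hXv)] with w hw
        rw [hw, mul_add]
  have pr_g : ∀ v v', Probe (z₀ v) (u v) (g v') (if v' = v then 1 else 0) := by
    intro v v'
    have h1 := (pr_step v v').add ((pr_rest v (α v')).add (pr_rest v (β v')))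
    rw [add_zero, add_zero] at h1
    refine h1.congr ?_
    filter_upwards [hT' (α v') (X v') (z₀ v) (hX v), hT' (β v') (X v') (z₀ v) (hX v)]
      with w h2 h3
    simp only [g, h2, h3]
    ring
  have pr_zero : ∀ v, ∀ h : ℝ × ℝ → ZMod 2, (∀ z ∉ F, h z = 0) → Probe (z₀ v) (u v) h 0 := by
    intro v h hh
    -- Small probes avoid all the lines, hence F, so a relation valid off F can be probed.
    have hoff : ∀ᶠ δ in 𝓝[>] (0 : ℝ), ∀ j γ, (z₀ v + δ • u v j).2 ≠ L γ (z₀ v + δ • u v j).1 := by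
      refine eventually_all.2 fun j => eventually_all.2 fun γ => ?_
      by_cases hγ : L γ (X v) = L (α v) (X v)
      · filter_upwards [self_mem_nhdsWithin] with δ hδ h1
        have hδ' : δ ≠ 0 := (show 0 < δ from hδ).ne'
        have h2 := hon v γ hγ
        have h3 : (u v j).2 ≠ m γ * (u v j).1 := by
          have := hμ v γ hγ
          fin_cases j
          · simp [u]
          · simp [u]
          · simpa [u] using this.symm
          · simpa [u] using this.symm
        apply h3
        rw [hL] at h1
        simp only [Prod.snd_add, Prod.fst_add, Prod.smul_snd, Prod.smul_fst, smul_eq_mul] at h1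
        apply mul_left_cancel₀ hδ'
        linarith
      · have hopen : IsOpen {w : ℝ × ℝ | w.2 ≠ L γ w.1} :=
          isOpen_ne_fun continuous_snd ((hLc γ).comp continuous_fst)
        exact (tendsto_probe _ _).eventually (hopen.mem_nhds (fun h' => hγ h'.symm))
    filter_upwards [hoff] with δ hδ
    refine Finset.sum_eq_zero fun j _ => hh _ ?_
    rintro ⟨γ, -, h1⟩
    exact hδ j γ h1
  -- the dual functionals at abscissa 0
  let y₀ : Fin n → ℝ × ℝ := fun i => (0, L (i, k₀) 0)
  -- At abscissa 0 no other line passes through the arm `k₀` of curve i, so a probe above and one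
  -- below detect exactly that arm.
  let e : Fin 2 → ℝ × ℝ := ![(0, 1), (0, -1)]
  have qr_below : ∀ i γ, Probe (y₀ i) e (below (L γ)) (if γ = (i, k₀) then 1 else 0) := by
    intro i γ
    by_cases h : γ = (i, k₀)
    · have h1 : (y₀ i).2 = m γ * (y₀ i).1 + q γ := by simp only [y₀, hL, h]
      have := Probe.below_line (u := e) h1
      rw [← hL] at this
      convert this using 1
      simp only [e, Fin.sum_univ_two, Matrix.cons_val]
      norm_num [h]
    · rw [if_neg h]
      exact (Probe.const (by decide) _).congr
        (eventually_below_eq (hLc γ) (fun h' => hzero i γ h h'.symm))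
  have qr_s : ∀ i i', Probe (y₀ i) e (s i') (if i' = i then 1 else 0) := by
    intro i i'
    have := (Probe.sum (s := Finset.univ) fun k _ => qr_below i (i', k)).congr
      (hs' i' (y₀ i) (by simp [y₀]))
    convert this using 1
    simp [Prod.ext_iff, ite_and]
  have qr_zero : ∀ i, ∀ h : ℝ × ℝ → ZMod 2, (∀ z ∉ F, h z = 0) → Probe (y₀ i) e h 0 := by
    intro i h hh
    have hoff : ∀ᶠ δ in 𝓝[>] (0 : ℝ), ∀ j γ, (y₀ i + δ • e j).2 ≠ L γ (y₀ i + δ • e j).1 := by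
      refine eventually_all.2 fun j => eventually_all.2 fun γ => ?_
      by_cases hγ : γ = (i, k₀)
      · filter_upwards [self_mem_nhdsWithin] with δ hδ h1
        have hδ' : δ ≠ 0 := (show 0 < δ from hδ).ne'
        rw [hγ] at h1
        fin_cases j <;> simp [y₀, e, hδ'] at h1
      · have hopen : IsOpen {w : ℝ × ℝ | w.2 ≠ L γ w.1} :=
          isOpen_ne_fun continuous_snd ((hLc γ).comp continuous_fst)
        exact (tendsto_probe _ _).eventually (hopen.mem_nhds (fun h' => hzero i γ hγ h'.symm))
    filter_upwards [hoff] with δ hδ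
    refine Finset.sum_eq_zero fun j _ => hh _ ?_
    rintro ⟨γ, -, h1⟩
    exact hδ j γ h1
  -- assembly
  let f : Option (Fin n ⊕ ι) → ℝ × ℝ → ZMod 2 := fun o => o.elim (fun _ => 1) (Sum.elim s g)
  have hcard : Fintype.card (Option (Fin n ⊕ ι)) = 1 + n + Fintype.card ι := by
    simp only [Fintype.card_option, Fintype.card_sum, Fintype.card_fin]; ring
  rw [← hcard]
  refine card_le_encard_regions f ?_ ?_
  · rintro (_ | i | v) z hz
    · simp [f]
    · exact hs i z hz
    · exact hg v z hz
  intro c hc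
  have hc' : ∀ z ∉ F, c none + (∑ i, c (some (Sum.inl i)) * s i z +
      ∑ v, c (some (Sum.inr v)) * g v z) = 0 := by
    intro z hz
    have := hc z hz
    simpa [f, Fintype.sum_option, Fintype.sum_sum_type] using this
  -- Crossings come first: the four-point probes kill the constant and all side functions, whereas
  -- the two-point probes are evaluated only on the constant and the side functions.
  have hcv : ∀ v, c (some (Sum.inr v)) = 0 := by
    intro v
    have h1 := (Probe.const (z := z₀ v) (u := u v) (by decide) (c none)).add
      ((Probe.sum (s := Finset.univ) fun i _ => (pr_s v i).mul_left (c (some (Sum.inl i)))).add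
      (Probe.sum (s := Finset.univ) fun v' _ => (pr_g v v').mul_left (c (some (Sum.inr v')))))
    have h2 := h1.unique (pr_zero v _ hc')
    simpa using h2
  simp only [hcv, zero_mul, Finset.sum_const_zero, add_zero] at hc'
  have hci : ∀ i, c (some (Sum.inl i)) = 0 := by
    intro i
    have h1 := (Probe.const (z := y₀ i) (u := e) (by decide) (c none)).add
      (Probe.sum (s := Finset.univ) fun i' _ => (qr_s i i').mul_left (c (some (Sum.inl i'))))
    have h2 := h1.unique (qr_zero i _ hc')
    simpa using h2
  simp only [hci, zero_mul, Finset.sum_const_zero, add_zero] at hc'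
  have hne : ∃ z, z ∉ F := by
    obtain ⟨y, hy⟩ := Infinite.exists_notMem_finset (Finset.univ.image fun γ => L γ 0)
    refine ⟨(0, y), ?_⟩
    rintro ⟨γ, -, h⟩
    exact hy (Finset.mem_image.2 ⟨γ, Finset.mem_univ _, h.symm⟩)
  obtain ⟨z, hz⟩ := hne
  rintro (_ | i | v)
  · exact hc' z hz
  · exact hci i
  · exact hcv v

/-! ### The profiles of Z and W. -/

theorem exists_stepFrom_mul_eventually_const {L L' : ℝ → ℝ} {s : ℝ} (h : L s = L' s) (z : ℝ × ℝ) :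
    ∃ κ, ∀ᶠ x in 𝓝 z.1, stepFrom s x * (below L z + below L' z) = κ := by
  by_cases hs : s = z.1
  · have : below L z = below L' z := by simp only [below, ← hs, h]
    rw [this, CharTwo.add_self_eq_zero]
    exact ⟨0, by simp⟩
  · refine ⟨stepFrom s z.1 * (below L z + below L' z), ?_⟩
    filter_upwards [eventually_stepFrom_eq hs] with x hx
    rw [hx]

theorem stepFrom_of_le {s x : ℝ} (h : s ≤ x) : stepFrom s x = 1 := if_pos h

theorem stepFrom_of_lt {s x : ℝ} (h : x < s) : stepFrom s x = 0 := if_neg (not_le.2 h)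

/-- The profile of a long-legged Z with corners at the abscissas `1` and `-1`. -/
noncomputable def profileZ : Profile 3 where
  dom := ![Iic 1, Icc (-1) 1, Ici (-1)]
  isClosed_dom := by simp [Fin.forall_fin_succ, isClosed_Iic, isClosed_Icc, isClosed_Ici]
  full := ![fun x => 1 + stepFrom 1 x, fun x => stepFrom (-1) x + stepFrom 1 x, stepFrom (-1)]
  -- Arm 1 is traversed leftwards, so its part after s is [-1, s); on the other arms it lies to the
  -- right of s. Sums of steps modulo 2 are half-open indicators.
  tail k s := ![![fun x => stepFrom s x + stepFrom 1 x,
      fun x => stepFrom (-1) x + stepFrom 1 x, stepFrom (-1)],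
    ![0, fun x => stepFrom (-1) x + stepFrom s x, stepFrom (-1)],
    ![0, 0, stepFrom s]] k
  rest := ![![0, 1, 1], ![0, 1, 1], ![0, 0, 0]]
  full_eq_zero := by
    have h2 : (1 : ZMod 2) + 1 = 0 := by decide
    simp only [Fin.forall_fin_succ, Matrix.cons_val_zero, Matrix.cons_val_succ, mem_Iic, mem_Icc,
      mem_Ici, not_le, not_and_or]
    refine ⟨fun x hx => ?_, fun x hx => ?_, fun x hx => ?_, fun i => i.elim0⟩
    · rw [stepFrom_of_le hx.le, h2]
    · rcases hx with hx | hx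
      · rw [stepFrom_of_lt hx, stepFrom_of_lt (by linarith), add_zero]
      · rw [stepFrom_of_le hx.le, stepFrom_of_le (by linarith), h2]
    · rw [stepFrom_of_lt hx]
  tail_eq_zero := by
    have h2 : (1 : ZMod 2) + 1 = 0 := by decide
    rintro k s ⟨hs, hs'⟩ k' x hx
    fin_cases k <;> fin_cases k' <;> simp at hx ⊢
    · rw [stepFrom_of_le hx.le, stepFrom_of_le (by linarith), h2]
    · rcases lt_or_ge x (-1) with h | h
      · rw [stepFrom_of_lt h, stepFrom_of_lt (by linarith), add_zero]
      · rw [stepFrom_of_le h, stepFrom_of_le (hx h).le, h2]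
    · rw [stepFrom_of_lt hx]
    · rcases lt_or_ge x (-1) with h | h
      · rw [stepFrom_of_lt h, stepFrom_of_lt (by linarith), add_zero]
      · rw [stepFrom_of_le h, stepFrom_of_le (by linarith [hx h]), h2]
    · rw [stepFrom_of_lt hx]
    · rw [stepFrom_of_lt (by linarith)]
  full_strip := by
    rintro k x ⟨hx, hx'⟩
    fin_cases k <;> simp [stepFrom_of_le hx.le, stepFrom_of_lt hx']
  tail_strip := by
    rintro k s k' x ⟨hx, hx'⟩
    fin_cases k <;> fin_cases k' <;> simp [stepFrom_of_le hx.le, stepFrom_of_lt hx', add_comm]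

/-- Grouped by abscissa, the steps at a corner pair the two arms meeting there, and such a pair does
not jump. In a tail only the step at its starting point survives. -/
theorem profileZ_fits {L : Fin 3 → ℝ → ℝ} (h0 : L 0 1 = L 1 1) (h1 : L 1 (-1) = L 2 (-1)) :
    profileZ.Fits L := by
  have hc (z : ℝ × ℝ) := exists_stepFrom_mul_eventually_const h0 z
  have hc' (z : ℝ × ℝ) := exists_stepFrom_mul_eventually_const h1 z
  refine ⟨fun z => ?_, fun k s _ z => ?_⟩
  · obtain ⟨κ, hκ⟩ := hc z
    obtain ⟨κ', hκ'⟩ := hc' z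
    refine ⟨below (L 0) z + κ + κ', ?_⟩
    filter_upwards [hκ, hκ'] with x h h'
    rw [← h, ← h', Fin.sum_univ_three]
    simp [profileZ]
    ring
  · obtain ⟨κ, hκ⟩ := hc z
    obtain ⟨κ', hκ'⟩ := hc' z
    fin_cases k
    · refine ⟨κ + κ', ?_⟩
      filter_upwards [hκ, hκ'] with x h h'
      rw [← h, ← h', Fin.sum_univ_three]
      simp [profileZ]
      ring
    · refine ⟨κ', ?_⟩
      filter_upwards [hκ'] with x h'
      rw [← h', Fin.sum_univ_three]
      simp [profileZ]
      ring
    · refine ⟨0, Eventually.of_forall fun x => ?_⟩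
      rw [Fin.sum_univ_three]
      simp [profileZ]

/-- The profile of a long-legged W with corners at the abscissas `1`, `-1` and `1`. -/
noncomputable def profileW : Profile 4 where
  dom := ![Iic 1, Icc (-1) 1, Icc (-1) 1, Iic 1]
  isClosed_dom := by simp [Fin.forall_fin_succ, isClosed_Iic, isClosed_Icc]
  full := ![fun x => 1 + stepFrom 1 x, fun x => stepFrom (-1) x + stepFrom 1 x,
    fun x => stepFrom (-1) x + stepFrom 1 x, fun x => 1 + stepFrom 1 x]
  -- Arms 1 and 3 are traversed leftwards, so their parts after s lie to the left of s.
  tail k s := ![![fun x => stepFrom s x + stepFrom 1 x, fun x => stepFrom (-1) x + stepFrom 1 x,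
      fun x => stepFrom (-1) x + stepFrom 1 x, fun x => 1 + stepFrom 1 x],
    ![0, fun x => stepFrom (-1) x + stepFrom s x,
      fun x => stepFrom (-1) x + stepFrom 1 x, fun x => 1 + stepFrom 1 x],
    ![0, 0, fun x => stepFrom s x + stepFrom 1 x, fun x => 1 + stepFrom 1 x],
    ![0, 0, 0, fun x => 1 + stepFrom s x]] k
  rest := ![![0, 1, 1, 1], ![0, 1, 1, 1], ![0, 0, 0, 1], ![0, 0, 0, 1]]
  full_eq_zero := by
    have h2 : (1 : ZMod 2) + 1 = 0 := by decide
    have key : ∀ x : ℝ, x < -1 ∨ 1 < x → stepFrom (-1) x + stepFrom 1 x = 0 := by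
      rintro x (hx | hx)
      · rw [stepFrom_of_lt hx, stepFrom_of_lt (by linarith), add_zero]
      · rw [stepFrom_of_le (by linarith), stepFrom_of_le (by linarith), h2]
    have key' : ∀ x : ℝ, 1 < x → 1 + stepFrom 1 x = 0 := fun x hx => by
      rw [stepFrom_of_le hx.le, h2]
    simp only [Fin.forall_fin_succ, Matrix.cons_val_zero, Matrix.cons_val_succ, mem_Iic, mem_Icc,
      not_le, not_and_or]
    exact ⟨key', key, key, key', fun i => i.elim0⟩
  tail_eq_zero := by
    have h2 : (1 : ZMod 2) + 1 = 0 := by decide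
    rintro k s ⟨hs, hs'⟩ k' x hx
    have key : (-1 ≤ x → 1 < x) → ∀ r, -1 < r → r ≤ 1 → stepFrom (-1) x + stepFrom r x = 0 := by
      intro hx r hr hr'
      rcases lt_or_ge x (-1) with h | h
      · rw [stepFrom_of_lt h, stepFrom_of_lt (by linarith), add_zero]
      · rw [stepFrom_of_le h, stepFrom_of_le (by linarith [hx h]), h2]
    have key' : 1 < x → ∀ r ≤ 1, stepFrom r x = 1 := fun hx r hr => stepFrom_of_le (by linarith)
    fin_cases k <;> fin_cases k' <;> simp at hx ⊢
    · rw [key' hx s hs'.le, key' hx 1 le_rfl, h2]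
    · exact key hx 1 (by norm_num) le_rfl
    · exact key hx 1 (by norm_num) le_rfl
    · rw [key' hx 1 le_rfl, h2]
    · exact key hx s hs hs'.le
    · exact key hx 1 (by norm_num) le_rfl
    · rw [key' hx 1 le_rfl, h2]
    · rcases lt_or_ge x (-1) with h | h
      · rw [stepFrom_of_lt (by linarith), stepFrom_of_lt (by linarith), add_zero]
      · rw [key' (hx h) s hs'.le, key' (hx h) 1 le_rfl, h2]
    · rw [key' hx 1 le_rfl, h2]
    · rw [key' hx s hs'.le, h2]
  full_strip := by
    rintro k x ⟨hx, hx'⟩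
    fin_cases k <;> simp [stepFrom_of_le hx.le, stepFrom_of_lt hx']
  tail_strip := by
    rintro k s k' x ⟨hx, hx'⟩
    fin_cases k <;> fin_cases k' <;> simp [stepFrom_of_le hx.le, stepFrom_of_lt hx', add_comm]

theorem profileW_fits {L : Fin 4 → ℝ → ℝ} (h0 : L 0 1 = L 1 1) (h1 : L 1 (-1) = L 2 (-1))
    (h2 : L 2 1 = L 3 1) : profileW.Fits L := by
  have hc (z : ℝ × ℝ) := exists_stepFrom_mul_eventually_const h0 z
  have hc' (z : ℝ × ℝ) := exists_stepFrom_mul_eventually_const h1 z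
  have hc'' (z : ℝ × ℝ) := exists_stepFrom_mul_eventually_const h2 z
  refine ⟨fun z => ?_, fun k s _ z => ?_⟩
  · obtain ⟨κ, hκ⟩ := hc z
    obtain ⟨κ', hκ'⟩ := hc' z
    obtain ⟨κ'', hκ''⟩ := hc'' z
    refine ⟨below (L 0) z + κ + κ' + κ'' + below (L 3) z, ?_⟩
    filter_upwards [hκ, hκ', hκ''] with x h h' h''
    rw [← h, ← h', ← h'', Fin.sum_univ_four]
    simp [profileW]
    ring
  · obtain ⟨κ, hκ⟩ := hc z
    obtain ⟨κ', hκ'⟩ := hc' z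
    obtain ⟨κ'', hκ''⟩ := hc'' z
    fin_cases k
    · refine ⟨κ + κ' + κ'' + below (L 3) z, ?_⟩
      filter_upwards [hκ, hκ', hκ''] with x h h' h''
      rw [← h, ← h', ← h'', Fin.sum_univ_four]
      simp [profileW]
      ring
    · refine ⟨κ' + κ'' + below (L 3) z, ?_⟩
      filter_upwards [hκ', hκ''] with x h' h''
      rw [← h', ← h'', Fin.sum_univ_four]
      simp [profileW]
      ring
    · refine ⟨κ'' + below (L 3) z, ?_⟩
      filter_upwards [hκ''] with x h''
      rw [← h'', Fin.sum_univ_four]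
      simp [profileW]
      ring
    · refine ⟨below (L 3) z, Eventually.of_forall fun x => ?_⟩
      rw [Fin.sum_univ_four]
      simp [profileW]
      ring

/-! ### Thin curves along tangents of a parabola. -/

/-- The line of an arm of a thin curve close to the tangent `y = 2 t x - t ^ 2` of a parabola. -/
def thinLine {d : ℕ} (μ κ : Fin d → ℝ) (ε t : ℝ) (k : Fin d) (x : ℝ) : ℝ :=
  (2 * t + ε * μ k) * x + (-t ^ 2 + ε * (κ k - μ k))

/-- Within one curve the differences between arms do not depend on t and scale with ε, so meeting at
the corners and separation in the strip are conditions on `μ` and `κ` alone. -/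
theorem thinLine_sub {d : ℕ} (μ κ : Fin d → ℝ) (ε t : ℝ) (k k' : Fin d) (x : ℝ) :
    thinLine μ κ ε t k x - thinLine μ κ ε t k' x =
      ε * ((μ k * (x - 1) + κ k) - (μ k' * (x - 1) + κ k')) := by
  simp only [thinLine]; ring

theorem card_sigma_fin (n : ℕ) : Fintype.card ((j : Fin n) × Fin j) = n.choose 2 := by
  simp only [Fintype.card_sigma, Fintype.card_fin]
  rw [Fin.sum_univ_eq_sum_range (fun i => i), Finset.sum_range_id, Nat.choose_two_right]

/-- Thin curves along tangents of a parabola all of whose arms cross in the strip `|x| < 1`. -/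
theorem Profile.exists_drawing {d : ℕ} (P : Profile d) (k₀ : Fin d) (μ κ : Fin d → ℝ)
    (hsep : ∀ k k', k ≠ k' → ∀ x ∈ Ioo (-1 : ℝ) 1, μ k * (x - 1) + κ k ≠ μ k' * (x - 1) + κ k')
    (hfit : ∀ ε t, P.Fits (thinLine μ κ ε t)) (n : ℕ) :
    ∃ (ε : ℝ) (t : Fin n → ℝ), 0 < ε ∧ ((1 + n + d ^ 2 * n.choose 2 : ℕ) : ℕ∞) ≤
      (regions (P.drawing fun γ => thinLine μ κ ε (t γ.1) γ.2)).encard := by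
  classical
  -- Distinct points of (0, 1): the tangents at t and t' then meet at abscissa (t + t')/2, inside
  -- the strip.
  let t : Fin n → ℝ := fun i => 1 / (i + 2)
  have ht0 : ∀ i, 0 < t i := fun i => by positivity
  have ht1 : ∀ i, t i < 1 := fun i => by
    simp only [t]
    rw [div_lt_one (by positivity)]
    have : (0 : ℝ) ≤ i := Nat.cast_nonneg _
    linarith
  have htinj : ∀ i j, i ≠ j → t i ≠ t j := by
    intro i j hij h
    apply hij
    simp only [t, one_div, inv_inj, add_left_inj, Nat.cast_inj] at h
    exact Fin.ext h
  let M : ℝ → Fin n × Fin d → ℝ := fun ε γ => 2 * t γ.1 + ε * μ γ.2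
  let Q : ℝ → Fin n × Fin d → ℝ := fun ε γ => -t γ.1 ^ 2 + ε * (κ γ.2 - μ γ.2)
  let X : ℝ → Fin n × Fin d → Fin n × Fin d → ℝ := fun ε γ γ' =>
    -(Q ε γ - Q ε γ') / (M ε γ - M ε γ')
  have hM : ∀ γ, Continuous fun ε => M ε γ := fun γ => by fun_prop
  have hQ : ∀ γ, Continuous fun ε => Q ε γ := fun γ => by fun_prop
  have hd : ∀ γ γ' : Fin n × Fin d, γ.1 ≠ γ'.1 → M 0 γ - M 0 γ' ≠ 0 := by
    intro γ γ' h h'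
    apply htinj _ _ h
    simp only [M] at h'
    linarith
  have hXc : ∀ γ γ' : Fin n × Fin d, γ.1 ≠ γ'.1 → ContinuousAt (fun ε => X ε γ γ') 0 := by
    intro γ γ' h
    exact ((hQ γ).sub (hQ γ')).neg.continuousAt.div ((hM γ).sub (hM γ')).continuousAt (hd γ γ' h)
  have hX0 : ∀ γ γ' : Fin n × Fin d, γ.1 ≠ γ'.1 → X 0 γ γ' = (t γ.1 + t γ'.1) / 2 := by
    intro γ γ' h
    simp only [X]
    rw [div_eq_iff (hd γ γ' h)]
    simp only [M, Q]
    ring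
  -- These are finitely many open conditions that hold at ε = 0, where each curve collapses to a
  -- tangent; hence they hold for some ε > 0.
  have e1 : ∀ᶠ ε in 𝓝 (0 : ℝ), ∀ γ γ' : Fin n × Fin d, γ.1 ≠ γ'.1 → M ε γ - M ε γ' ≠ 0 := by
    simp only [eventually_all]
    exact fun γ γ' h => ((hM γ).sub (hM γ')).continuousAt.eventually_ne (hd γ γ' h)
  have e2 : ∀ᶠ ε in 𝓝 (0 : ℝ), ∀ γ γ' : Fin n × Fin d, γ.1 ≠ γ'.1 →
      X ε γ γ' ∈ Ioo (-1 : ℝ) 1 := by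
    simp only [eventually_all]
    intro γ γ' h
    refine (hXc γ γ' h).eventually (isOpen_Ioo.mem_nhds ?_)
    change X 0 γ γ' ∈ Ioo (-1 : ℝ) 1
    rw [hX0 γ γ' h]
    constructor <;> linarith [ht0 γ.1, ht0 γ'.1, ht1 γ.1, ht1 γ'.1]
  have e3 : ∀ᶠ ε in 𝓝 (0 : ℝ), ∀ γ γ' δ : Fin n × Fin d, γ.1 ≠ γ'.1 → δ.1 ≠ γ.1 → δ.1 ≠ γ'.1 →
      (M ε δ * X ε γ γ' + Q ε δ) - (M ε γ * X ε γ γ' + Q ε γ) ≠ 0 := by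
    simp only [eventually_all]
    intro γ γ' δ h h1 h2
    refine ContinuousAt.eventually_ne ((((hM δ).continuousAt.mul (hXc γ γ' h)).add
      (hQ δ).continuousAt).sub (((hM γ).continuousAt.mul (hXc γ γ' h)).add
      (hQ γ).continuousAt)) ?_
    rw [hX0 γ γ' h]
    -- Nonvanishing of this product says that no three of the tangents are concurrent.
    have : (M 0 δ * ((t γ.1 + t γ'.1) / 2) + Q 0 δ) - (M 0 γ * ((t γ.1 + t γ'.1) / 2) + Q 0 γ) =
        -((t δ.1 - t γ.1) * (t δ.1 - t γ'.1)) := by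
      simp only [M, Q]; ring
    rw [this]
    exact neg_ne_zero.2 (mul_ne_zero (sub_ne_zero.2 (htinj _ _ h1)) (sub_ne_zero.2 (htinj _ _ h2)))
  have e4 : ∀ᶠ ε in 𝓝 (0 : ℝ), ∀ γ γ' : Fin n × Fin d, γ.1 ≠ γ'.1 → Q ε γ - Q ε γ' ≠ 0 := by
    simp only [eventually_all]
    intro γ γ' h
    refine ((hQ γ).sub (hQ γ')).continuousAt.eventually_ne ?_
    have : Q 0 γ - Q 0 γ' = -((t γ.1 - t γ'.1) * (t γ.1 + t γ'.1)) := by simp only [Q]; ring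
    change Q 0 γ - Q 0 γ' ≠ 0
    rw [this]
    exact neg_ne_zero.2 (mul_ne_zero (sub_ne_zero.2 (htinj _ _ h))
      (by linarith [ht0 γ.1, ht0 γ'.1]))
  obtain ⟨ε, ⟨⟨⟨h1, h2⟩, h3⟩, h4⟩, hε⟩ := ((eventually_nhdsWithin_of_eventually_nhds
    (((e1.and e2).and e3).and e4)).and (self_mem_nhdsWithin (s := Ioi (0 : ℝ)))).exists
  have hε' : 0 < ε := hε
  refine ⟨ε, t, hε', ?_⟩
  have hL : ∀ (γ : Fin n × Fin d) x, thinLine μ κ ε (t γ.1) γ.2 x = M ε γ * x + Q ε γ :=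
    fun γ x => rfl
  have hsame : ∀ γ γ' : Fin n × Fin d, γ.1 = γ'.1 → γ ≠ γ' → ∀ x ∈ Ioo (-1 : ℝ) 1,
      thinLine μ κ ε (t γ.1) γ.2 x ≠ thinLine μ κ ε (t γ'.1) γ'.2 x := by
    intro γ γ' h hne x hx h'
    rw [h, ← sub_eq_zero, thinLine_sub] at h'
    refine hsep γ.2 γ'.2 (fun h'' => hne (Prod.ext h h'')) x hx (sub_eq_zero.1 ?_)
    exact (mul_eq_zero.1 h').resolve_left hε'.ne'
  -- A pair of distinct curves, the larger index first, and an arm on each.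
  let ι := ((j : Fin n) × Fin j) × Fin d × Fin d
  let α : ι → Fin n × Fin d := fun v => (v.1.1, v.2.1)
  let β : ι → Fin n × Fin d := fun v => (Fin.castLE v.1.1.is_lt.le v.1.2, v.2.2)
  have hlt : ∀ v, (β v).1 < (α v).1 := fun v => v.1.2.is_lt
  have hαβ : ∀ v, (α v).1 ≠ (β v).1 := fun v => (hlt v).ne'
  have hcard : d ^ 2 * n.choose 2 = Fintype.card ι := by
    simp only [ι, Fintype.card_prod, card_sigma_fin, Fintype.card_fin]; ring
  have hmeet : ∀ v, M ε (α v) * X ε (α v) (β v) + Q ε (α v) =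
      M ε (β v) * X ε (α v) (β v) + Q ε (β v) := by
    intro v
    have h := h1 _ _ (hαβ v)
    have : (M ε (α v) - M ε (β v)) * X ε (α v) (β v) = -(Q ε (α v) - Q ε (β v)) := by
      simp only [X]
      field_simp
    linarith
  have hother : ∀ v γ, γ ≠ α v → γ ≠ β v → thinLine μ κ ε (t γ.1) γ.2 (X ε (α v) (β v)) ≠
      thinLine μ κ ε (t (α v).1) (α v).2 (X ε (α v) (β v)) := by
    intro v γ hγ hγ'
    by_cases hγ1 : γ.1 = (α v).1
    · exact hsame γ _ hγ1 hγ _ (h2 _ _ (hαβ v))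
    by_cases hγ2 : γ.1 = (β v).1
    · have := hsame γ _ hγ2 hγ' _ (h2 _ _ (hαβ v))
      rwa [hL (β v), ← hmeet, ← hL] at this
    · exact fun h => h3 _ _ γ (hαβ v) hγ1 hγ2 (sub_eq_zero.2 h)
  rw [hcard]
  refine P.le_encard_regions k₀ (M ε) (Q ε) _ (fun γ => rfl) (fun i => hfit ε (t i)) α β
    (fun v => X ε (α v) (β v)) (fun v => h2 _ _ (hαβ v))
    (fun v h => h1 _ _ (hαβ v) (sub_eq_zero.2 h)) hmeet hother ?_ ?_
  · intro v v' hX' hp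
    have hthrough : ∀ γ, thinLine μ κ ε (t γ.1) γ.2 (X ε (α v) (β v)) =
        thinLine μ κ ε (t (α v).1) (α v).2 (X ε (α v) (β v)) → γ = α v ∨ γ = β v := by
      intro γ h
      by_contra! h'
      exact hother v γ h'.1 h'.2 h
    have hp' := hthrough (β v') (by
      have := hmeet v'
      rw [hX'] at this
      exact this.symm.trans hp)
    have hp := hthrough (α v') hp
    have hα : α v' = α v ∧ β v' = β v := by
      have l1 := hlt v
      have l2 := hlt v'
      rcases hp with hp | hp <;> rcases hp' with hp' | hp'
      · rw [hp, hp'] at l2; exact (lt_irrefl _ l2).elim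
      · exact ⟨hp, hp'⟩
      · rw [hp, hp'] at l2; exact (lt_asymm l1 l2).elim
      · rw [hp, hp'] at l2; exact (lt_irrefl _ l2).elim
    obtain ⟨⟨j, i⟩, k, l⟩ := v
    obtain ⟨⟨j', i'⟩, k', l'⟩ := v'
    simp only [α, β, Prod.mk.injEq] at hα
    obtain ⟨⟨rfl, rfl⟩, hi, rfl⟩ := hα
    have : i' = i := Fin.ext (by simpa using congrArg Fin.val hi)
    rw [this]
  · intro i γ hγ
    by_cases h : γ.1 = i
    · exact hsame γ (i, k₀) h hγ 0 (by simp)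
    · intro h'
      rw [mul_zero, mul_zero, zero_add, zero_add] at h'
      exact h4 γ (i, k₀) h (sub_eq_zero.2 h')

/-! ### Thin curves as Z's and W's, and conclusion. -/

theorem exists_eq_add_smul_iff {I : Set ℝ} {p d z : ℝ × ℝ} (hd : d.1 ≠ 0) :
    (∃ s ∈ I, z = p + s • d) ↔ (z.1 - p.1) / d.1 ∈ I ∧ z.2 = p.2 + (z.1 - p.1) / d.1 * d.2 := by
  constructor
  · rintro ⟨s, hs, rfl⟩
    have : ((p + s • d).1 - p.1) / d.1 = s := by
      simp only [Prod.fst_add, Prod.smul_fst, smul_eq_mul]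
      field_simp
      ring
    rw [this]
    exact ⟨hs, rfl⟩
  · rintro ⟨h1, h2⟩
    refine ⟨_, h1, Prod.ext ?_ h2⟩
    simp only [Prod.fst_add, Prod.smul_fst, smul_eq_mul]
    field_simp
    ring

theorem mem_halfLine_iff {p d z : ℝ × ℝ} (hd : d.1 ≠ 0) :
    z ∈ halfLine p d ↔ 0 ≤ (z.1 - p.1) / d.1 ∧ z.2 = p.2 + (z.1 - p.1) / d.1 * d.2 :=
  exists_eq_add_smul_iff (I := Ici 0) hd

theorem mem_segment_add_iff {p d z : ℝ × ℝ} (hd : d.1 ≠ 0) :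
    z ∈ segment ℝ p (p + d) ↔
      (z.1 - p.1) / d.1 ∈ Icc (0 : ℝ) 1 ∧ z.2 = p.2 + (z.1 - p.1) / d.1 * d.2 := by
  rw [segment_add_right, ← exists_eq_add_smul_iff hd]
  simp only [mem_image, eq_comm]

theorem isLongLeggedZ_thin {ε : ℝ} (hε : 0 < ε) (t : ℝ) :
    IsLongLeggedZ {z | ∃ k, z.1 ∈ profileZ.dom k ∧
      z.2 = thinLine ![0, 1, 0] ![0, 0, -2] ε t k z.1} := by
  -- p is the corner at abscissa 1, and b leads to the corner at -1. The determinant of a, b is -4ε.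
  refine ⟨(1, 2 * t - t ^ 2), (2, 4 * t), (-2, -2 * (2 * t + ε)),
    linearIndependent_pair_of_det_ne_zero ?_, ?_⟩
  · dsimp; intro h; nlinarith
  · ext ⟨x, y⟩
    rw [mem_union, mem_union, mem_halfLine_iff (by norm_num), mem_segment_add_iff (by norm_num),
      mem_halfLine_iff (by norm_num)]
    simp only [mem_ofPred_eq, Fin.exists_fin_succ, profileZ, thinLine, Matrix.cons_val_zero,
      Matrix.cons_val_succ, IsEmpty.exists_iff, or_false, or_assoc, mem_Iic, mem_Icc, mem_Ici,
      Prod.mk_add_mk, Prod.neg_mk]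
    refine or_congr (and_congr ?_ ?_) (or_congr (and_congr ?_ ?_) (and_congr ?_ ?_)) <;>
      constructor <;> intro h <;>
      first | linarith | exact ⟨by linarith [h.1, h.2], by linarith [h.1, h.2]⟩

theorem isLongLeggedW_thin {ε : ℝ} (hε : 0 < ε) (t : ℝ) :
    IsLongLeggedW {z | ∃ k, z.1 ∈ profileW.dom k ∧
      z.2 = thinLine ![0, 1, 0, 1] ![0, 0, -2, -2] ε t k z.1} := by
  refine ⟨(1, 2 * t - t ^ 2), (2, 4 * t), (-2, -2 * (2 * t + ε)),
    linearIndependent_pair_of_det_ne_zero ?_, ?_⟩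
  · dsimp; intro h; nlinarith
  · ext ⟨x, y⟩
    rw [mem_union, mem_union, mem_union, mem_halfLine_iff (by norm_num),
      mem_segment_add_iff (by norm_num), mem_segment_add_iff (by norm_num),
      mem_halfLine_iff (by norm_num)]
    simp only [mem_ofPred_eq, Fin.exists_fin_succ, profileW, thinLine, Matrix.cons_val_zero,
      Matrix.cons_val_succ, IsEmpty.exists_iff, or_false, or_assoc, mem_Iic, mem_Icc,
      Prod.mk_add_mk, Prod.neg_mk]
    refine or_congr (and_congr ?_ ?_) (or_congr (and_congr ?_ ?_)
      (or_congr (and_congr ?_ ?_) (and_congr ?_ ?_))) <;>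
      constructor <;> intro h <;>
      first | linarith | exact ⟨by linarith [h.1, h.2], by linarith [h.1, h.2]⟩

theorem Profile.drawing_eq_iUnion {d n : ℕ} (P : Profile d) (L : Fin n × Fin d → ℝ → ℝ) :
    P.drawing L = ⋃ i, {z | ∃ k, z.1 ∈ P.dom k ∧ z.2 = L (i, k) z.1} := by
  ext z
  simp [Profile.drawing]

theorem isMaxRegions_Z (n : ℕ) : IsMaxRegions IsLongLeggedZ n (1 + n + 3 ^ 2 * n.choose 2) := by
  have hub : ∀ S : Fin n → Set (ℝ × ℝ), (∀ i, IsLongLeggedZ (S i)) →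
      (regions (⋃ i, S i)).encard ≤ (1 + n + 3 ^ 2 * n.choose 2 : ℕ) := fun S hS =>
    encard_regions_iUnion_le S fun i => (hS i).isStaircase
  refine ⟨?_, ?_⟩
  -- The offsets are 0, x - 1 and -2: they are distinct on the open strip, the first two meet at 1
  -- and the last two at -1.
  · obtain ⟨ε, t, hε, h⟩ := profileZ.exists_drawing 0 ![0, 1, 0] ![0, 0, -2] (by
      rintro k k' hk x ⟨hx, hx'⟩
      fin_cases k <;> fin_cases k' <;> simp at hk ⊢ <;> intro h <;> linarith) (fun ε t =>
      profileZ_fits (by simp [thinLine]; ring) (by simp [thinLine]; ring)) n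
    rw [Profile.drawing_eq_iUnion] at h
    have hS := fun i : Fin n => isLongLeggedZ_thin hε (t i)
    exact ⟨_, hS, le_antisymm h (hub _ hS)⟩
  · rintro r ⟨S, hS, rfl⟩
    exact hub S hS

theorem isMaxRegions_W (n : ℕ) : IsMaxRegions IsLongLeggedW n (1 + n + 4 ^ 2 * n.choose 2) := by
  have hub : ∀ S : Fin n → Set (ℝ × ℝ), (∀ i, IsLongLeggedW (S i)) →
      (regions (⋃ i, S i)).encard ≤ (1 + n + 4 ^ 2 * n.choose 2 : ℕ) := fun S hS =>
    encard_regions_iUnion_le S fun i => (hS i).isStaircase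
  refine ⟨?_, ?_⟩
  -- To the offsets of the Z is added x - 3, which meets -2 at abscissa 1.
  · obtain ⟨ε, t, hε, h⟩ := profileW.exists_drawing 0 ![0, 1, 0, 1] ![0, 0, -2, -2] (by
      rintro k k' hk x ⟨hx, hx'⟩
      fin_cases k <;> fin_cases k' <;> simp at hk ⊢ <;> intro h <;> linarith) (fun ε t =>
      profileW_fits (by simp [thinLine]; ring) (by simp [thinLine]; ring)
        (by simp [thinLine]; ring)) n
    rw [Profile.drawing_eq_iUnion] at h
    have hS := fun i : Fin n => isLongLeggedW_thin hε (t i)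
    exact ⟨_, hS, le_antisymm h (hub _ hS)⟩
  · rintro r ⟨S, hS, rfl⟩
    exact hub S hS

theorem mainTheorem4 (n : ℕ) :
    (∃ m : ℕ, IsMaxRegions IsLongLeggedW n m ∧ (m : ℚ) = 8 * (n : ℚ) ^ 2 - 7 * n + 1) ∧
    (∃ m : ℕ, IsMaxRegions IsLongLeggedM n m ∧ (m : ℚ) = 8 * (n : ℚ) ^ 2 - 7 * n + 1) ∧
    (∃ m : ℕ, IsMaxRegions IsLongLeggedZ n m ∧ (m : ℚ) = (9 * (n : ℚ) ^ 2 - 7 * n + 2) / 2) := by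
  have hMW : IsLongLeggedM = IsLongLeggedW := funext fun _ => propext isLongLeggedM_iff
  refine ⟨⟨_, isMaxRegions_W n, ?_⟩, ⟨_, hMW ▸ isMaxRegions_W n, ?_⟩, ⟨_, isMaxRegions_Z n, ?_⟩⟩ <;>
  · push_cast [Nat.cast_choose_two]
    ring
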